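/- Let $n\in\mathbb N$ and $\lambda>0$, and let $\mathbb A^{(\lambda)}(\mathbb D^n)$ be the Hilbert space of holomorphic functions on the polydisc $\mathbb D^n$ with reproducing kernel $K^{(\lambda)}(\boldsymbol z,\boldsymbol w)=\prod_{j=1}^n(1-z_j\bar w_j)^{-\lambda}$. Let $\boldsymbol s=(s_1,\dots,s_n):\mathbb C^n\to\mathbb C^n$ be given by the elementary symmetric polynomials $s_k(\boldsymbol z)=\sum_{1\le i_1<\dots<i_k\le n}z_{i_1}\cdots z_{i_k}$, and put $\mathbb G_n=\boldsymbol s(\mathbb D^n)$ and $\mathcal Z=\{\boldsymbol z\in\mathbb D^n: z_i=z_j\text{ for some }i\ne j\}$. The symmetric group $\mathfrak S_n$ acts by $\sigma\cdot\boldsymbol z=(z_{\sigma^{-1}(1)},\dots,z_{\sigma^{-1}(n)})$. For a partition $\boldsymbol p$ of $n$ let $\chi_{\boldsymbol p}$ be the character of the corresponding irreducible representation of $\mathfrak S_n$ (the left ideal of $\mathbb C[\mathfrak S_n]$ generated by a Young symmetrizer of shape $\boldsymbol p$), and put $$\mathbb P_{\boldsymbol p}f(\boldsymbol z)=\frac{\chi_{\boldsymbol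 p}(1)}{n!}\sum_{\sigma\in\mathfrak S_n}\overline{\chi_{\boldsymbol p}(\sigma)}\,f(\sigma^{-1}\cdot\boldsymbol z),\qquad f\in\mathbb A^{(\lambda)}(\mathbb D^n).$$ A Hilbert module $\mathcal H$ over $\mathbb C[u_1,\dots,u_n]$ is a Hilbert space on which polynomials act by bounded operators. For $\boldsymbol w\in\mathbb C^n$ let $\mathbb C_{\boldsymbol w}$ be the module $\mathbb C$ on which $q$ acts as $q(\boldsymbol w)$. The module tensor product $\mathcal H\otimes\mathbb C_{\boldsymbol w}$ is the quotient of $\mathcal H$ by the closed linear span of $\{(q-q(\boldsymbol w))\cdot f: q\in\mathbb C[u_1,\dots,u_n],\,f\in\mathcal H\}$, identified with the orthogonal complement of this set in $\mathcal H$. For $\Omega\subseteq\mathbb C^n$, $\mathcal H$ is locally free of rank $k$ on $\Omega$ if every $\boldsymbol w\in\Omega^*=\{\boldsymbol w:\bar{\boldsymbol w}\in\Omega\}$ has an open neighbourhood $U$ with holomorphic functions $\gamma_1,\dots,\gamma_k:U\to\mathcal H$ such that, for every $\boldsymbol z\in U$, the vectors $\gamma_1(\boldsymbol z),\dots,\gamma_k(\boldsymbol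 z)$ form a basis of $\mathcal H\otimes\mathbb C_{\bar{\boldsymbol z}}$. Then, for every $n$, every $\lambda>0$ and every partition $\boldsymbol p$ of $n$, the image $\mathbb P_{\boldsymbol p}\big(\mathbb A^{(\lambda)}(\mathbb D^n)\big)$ is complete, and is thus, under pointwise multiplication, a Hilbert module over the ring $\mathbb C[\boldsymbol z]^{\mathfrak S_n}=\mathbb C[s_1,\dots,s_n]$ of symmetric polynomials. Regarded as a Hilbert module over $\mathbb C[u_1,\dots,u_n]$ through the isomorphism $u_k\mapsto s_k$, it is locally free of rank $\chi_{\boldsymbol p}(1)^2$ on $\mathbb G_n\setminus\boldsymbol s(\mathcal Z)$. -/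

import Mathlib

open scoped ComplexConjugate ComplexOrder InnerProductSpace

namespace BergmanPolydisc

/-- Positive semidefiniteness of a scalar kernel on a set. -/
def IsPosKernel {X : Type*} (A : X → X → ℂ) : Prop :=
  ∀ (s : Finset X) (a : X → ℂ), 0 ≤ ∑ x ∈ s, ∑ y ∈ s, conj (a x) * A x y * a y

theorem IsPosKernel.one {X : Type*} : IsPosKernel (fun _ _ : X => (1 : ℂ)) := by
  intro s a
  have : ∑ x ∈ s, ∑ y ∈ s, conj (a x) * 1 * a y = conj (∑ x ∈ s, a x) * ∑ x ∈ s, a x := by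
    rw [map_sum, Finset.sum_mul_sum]; simp
  rw [this, ← Complex.normSq_eq_conj_mul_self]
  exact_mod_cast Complex.normSq_nonneg _

theorem IsPosKernel.mul_hasSum {X ι : Type*} {A B : X → X → ℂ} (hA : IsPosKernel A)
    (c : ι → ℝ) (hc : ∀ m, 0 ≤ c m) (g : ι → X → ℂ)
    (hB : ∀ x y, HasSum (fun m => (c m : ℂ) * (g m x * conj (g m y))) (B x y)) :
    IsPosKernel (fun x y => A x y * B x y) := by
  intro s a
  have h : HasSum (fun m => ∑ x ∈ s, ∑ y ∈ s, conj (a x) * (A x y *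
      ((c m : ℂ) * (g m x * conj (g m y)))) * a y)
      (∑ x ∈ s, ∑ y ∈ s, conj (a x) * (A x y * B x y) * a y) :=
    hasSum_sum fun x _ => hasSum_sum fun y _ => (((hB x y).mul_left _).mul_left _).mul_right _
  refine h.nonneg fun m => ?_
  have : ∑ x ∈ s, ∑ y ∈ s, conj (a x) * (A x y * ((c m : ℂ) * (g m x * conj (g m y)))) * a y
      = (c m : ℂ) * ∑ x ∈ s, ∑ y ∈ s,
        conj (a x * conj (g m x)) * A x y * (a y * conj (g m y)) := by
    simp only [Finset.mul_sum, map_mul, Complex.conj_conj]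
    refine Finset.sum_congr rfl fun x _ => Finset.sum_congr rfl fun y _ => ?_
    ring
  rw [this]
  exact mul_nonneg (by exact_mod_cast hc m) (hA s fun x => a x * conj (g m x))

/-- Taylor coefficients of `(1 - x) ^ (-l)`. -/
noncomputable def binomCoeff (l : ℝ) (k : ℕ) : ℝ := Ring.choose (l + k - 1) k

theorem binomCoeff_zero (l : ℝ) : binomCoeff l 0 = 1 := by simp [binomCoeff]

theorem binomCoeff_succ (l : ℝ) (k : ℕ) :
    (k + 1) * binomCoeff l (k + 1) = (l + k) * binomCoeff l k := by
  have h (r : ℝ) (m : ℕ) : Ring.choose r m = (descPochhammer ℝ m).eval r / m.factorial := by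
    rw [Ring.choose_eq_smul, smul_eq_mul, ← Polynomial.aeval_eq_smeval, Polynomial.aeval_def,
      ← Polynomial.eval_map, descPochhammer_map]
    field_simp
  have e1 : (descPochhammer ℝ (k+1)).eval (l + ((k + 1 : ℕ) : ℝ) - 1) =
      (l + k) * (descPochhammer ℝ k).eval (l + k - 1) := by
    rw [descPochhammer_succ_left]
    have e2 : l + ((k + 1 : ℕ) : ℝ) - 1 = l + k := by push_cast; ring
    rw [e2]
    simp [Polynomial.eval_comp]
  unfold binomCoeff
  rw [h, h, e1, Nat.factorial_succ]
  push_cast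
  field_simp

theorem binomCoeff_pos {l : ℝ} (hl : 0 < l) (k : ℕ) : 0 < binomCoeff l k := by
  induction k with
  | zero => simp [binomCoeff_zero]
  | succ k ih =>
    have := binomCoeff_succ l k
    have h2 : 0 < (l + k) * binomCoeff l k := by positivity
    rw [← this] at h2
    exact (pos_iff_pos_of_mul_pos h2).1 (by positivity)

theorem hasSum_binomCoeff (l : ℝ) {x : ℂ} (hx : ‖x‖ < 1) :
    HasSum (fun k : ℕ => (binomCoeff l k : ℂ) * x ^ k) ((1 - x) ^ (-(l : ℂ))) := by
  have h := (Complex.one_div_one_sub_cpow_hasFPowerSeriesOnBall_zero (l : ℂ)).hasSum (y := x)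
    (by simpa [Metric.mem_eball, edist_zero_right, enorm_eq_nnnorm, ← NNReal.coe_lt_one] using hx)
  simp only [zero_add] at h
  rw [Complex.cpow_neg, ← one_div]
  refine Eq.mp (congrArg (fun f : ℕ → ℂ => HasSum f _) (funext fun k => ?_)) h
  simp [FormalMultilinearSeries.ofScalars, binomCoeff, Complex.ofReal_choose]


/-- The open unit polydisc. -/
def polydisc (n : ℕ) : Set (Fin n → ℂ) := {z | ∀ i, ‖z i‖ < 1}

/-- The kernel `K(z, w) = ∏ j, (1 - z_j * conj w_j) ^ (-l)` on the polydisc (the principal branch of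
the power, the base having positive real part). -/
noncomputable def bergmanKernel (n : ℕ) (l : ℝ) (z w : polydisc n) : ℂ :=
  ∏ j, (1 - z.1 j * conj (w.1 j)) ^ (-(l : ℂ))

theorem norm_mul_conj_lt {n : ℕ} (z w : polydisc n) (j : Fin n) :
    ‖z.1 j * conj (w.1 j)‖ < 1 := by
  rw [norm_mul, RCLike.norm_conj]
  exact mul_lt_one_of_nonneg_of_lt_one_left (norm_nonneg _) (z.2 j) (w.2 j).le

theorem hasSum_factor {n : ℕ} (l : ℝ) (j : Fin n) (z w : polydisc n) :
    HasSum (fun k : ℕ => (binomCoeff l k : ℂ) * (z.1 j ^ k * conj (w.1 j ^ k)))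
      ((1 - z.1 j * conj (w.1 j)) ^ (-(l : ℂ))) := by
  simpa [mul_pow] using hasSum_binomCoeff l (norm_mul_conj_lt z w j)

theorem isPosKernel_prod {n : ℕ} {l : ℝ} (hl : 0 < l) (s : Finset (Fin n)) :
    IsPosKernel fun z w : polydisc n => ∏ j ∈ s, (1 - z.1 j * conj (w.1 j)) ^ (-(l : ℂ)) := by
  classical
  induction s using Finset.induction_on with
  | empty => simpa using IsPosKernel.one
  | insert j s hj ih =>
    have e : (fun z w : polydisc n => ∏ j ∈ insert j s, (1 - z.1 j * conj (w.1 j)) ^ (-(l : ℂ))) =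
        fun z w => (∏ j ∈ s, (1 - z.1 j * conj (w.1 j)) ^ (-(l : ℂ))) *
          (1 - z.1 j * conj (w.1 j)) ^ (-(l : ℂ)) := by
      funext z w
      rw [Finset.prod_insert hj, mul_comm]
    rw [e]
    exact ih.mul_hasSum (binomCoeff l) (fun k => (binomCoeff_pos hl k).le)
      (fun k z => z.1 j ^ k) (hasSum_factor l j)

theorem isPosKernel_bergmanKernel {n : ℕ} {l : ℝ} (hl : 0 < l) :
    IsPosKernel (bergmanKernel n l) := isPosKernel_prod hl Finset.univ

theorem isPosKernel_shift {n : ℕ} {l : ℝ} (hl : 0 < l) (i : Fin n) :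
    IsPosKernel fun z w : polydisc n =>
      (((max 1 l⁻¹ : ℝ) : ℂ) - z.1 i * conj (w.1 i)) * bergmanKernel n l z w := by
  classical
  set C : ℝ := max 1 l⁻¹ with hC
  let c : ℕ → ℝ := fun k => C * binomCoeff l k - (if k = 0 then 0 else binomCoeff l (k - 1))
  have hc : ∀ k, 0 ≤ c k := by
    intro k
    cases k with
    | zero => simp [c, binomCoeff_zero, hC]
    | succ k =>
      have h1 := binomCoeff_succ l k
      have h2 := binomCoeff_pos hl k
      have h3 := binomCoeff_pos hl (k + 1)
      have hC1 : 1 ≤ C := le_max_left _ _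
      have hC2 : 1 ≤ C * l := by
        have : l⁻¹ * l ≤ C * l := mul_le_mul_of_nonneg_right (le_max_right _ _) hl.le
        rwa [inv_mul_cancel₀ hl.ne'] at this
      have h4 : (k + 1 : ℝ) ≤ C * (l + k) := by nlinarith [(Nat.cast_nonneg k : (0 : ℝ) ≤ k)]
      have h5 : (k + 1 : ℝ) * binomCoeff l k ≤ (k + 1) * (C * binomCoeff l (k + 1)) := by
        calc (k + 1 : ℝ) * binomCoeff l k ≤ C * (l + k) * binomCoeff l k :=
              mul_le_mul_of_nonneg_right h4 h2.le
          _ = _ := by rw [mul_assoc, ← h1]; ring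
      have h6 := le_of_mul_le_mul_left h5 (by positivity)
      simpa [c] using h6
  have hB : ∀ z w : polydisc n, HasSum (fun k => (c k : ℂ) * (z.1 i ^ k * conj (w.1 i ^ k)))
      (((C : ℂ) - z.1 i * conj (w.1 i)) * (1 - z.1 i * conj (w.1 i)) ^ (-(l : ℂ))) := by
    intro z w
    have h1 := hasSum_factor l i z w
    have h2 : HasSum (fun k : ℕ => ((if k = 0 then 0 else binomCoeff l (k - 1) : ℝ) : ℂ) *
        (z.1 i ^ k * conj (w.1 i ^ k)))
        (z.1 i * conj (w.1 i) * (1 - z.1 i * conj (w.1 i)) ^ (-(l : ℂ))) := by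
      rw [← hasSum_nat_add_iff' 1]
      refine Eq.mp (congrArg₂ (fun (f : ℕ → ℂ) a => HasSum f a) (funext fun k => ?_) ?_)
        (h1.mul_left (z.1 i * conj (w.1 i)))
      · simp [pow_succ]; ring
      · simp
    refine Eq.mp (congrArg₂ (fun (f : ℕ → ℂ) a => HasSum f a) (funext fun k => ?_) ?_)
      ((h1.mul_left (C : ℂ)).sub h2)
    · simp only [c]; push_cast; ring
    · ring
  have key := (isPosKernel_prod (n := n) hl (Finset.univ.erase i)).mul_hasSum c hc
    (fun k z => z.1 i ^ k) hB
  intro s a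
  refine (key s a).trans_eq ?_
  refine Finset.sum_congr rfl fun x _ => Finset.sum_congr rfl fun y _ => ?_
  simp only [bergmanKernel]
  rw [← Finset.mul_prod_erase _ _ (Finset.mem_univ i)]
  ring

/-- The kernel `bergmanKernel n l`, its values viewed as operators on `ℂ`. -/
noncomputable def bergmanMatrix (n : ℕ) (l : ℝ) :
    Matrix (polydisc n) (polydisc n) (ℂ →L[ℂ] ℂ) :=
  .of fun z w => bergmanKernel n l z w • ContinuousLinearMap.id ℂ ℂ

theorem bergmanKernel_conj {n : ℕ} (l : ℝ) (z w : polydisc n) :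
    conj (bergmanKernel n l z w) = bergmanKernel n l w z := by
  have h (z w : polydisc n) : bergmanKernel n l z w =
      ∏ j, ∑' k : ℕ, (binomCoeff l k : ℂ) * (z.1 j ^ k * conj (w.1 j ^ k)) :=
    Finset.prod_congr rfl fun j _ => (hasSum_factor l j z w).tsum_eq.symm
  rw [h, h, map_prod]
  refine Finset.prod_congr rfl fun j _ => ?_
  rw [Complex.conj_tsum]
  refine tsum_congr fun k => ?_
  simp [mul_comm]

theorem bergmanMatrix_posSemidef (n : ℕ) {l : ℝ} (hl : 0 < l) :
    (bergmanMatrix n l).PosSemidef := by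
  have tfae := (RKHS.posSemidef_tfae (K := bergmanMatrix n l)).out 0 2
  refine tfae.2 ⟨?_, fun v => ?_⟩
  · ext1 x y
    rw [Matrix.conjTranspose_apply]
    refine ContinuousLinearMap.ext_ring ?_
    refine ext_inner_right ℂ fun u => ?_
    rw [ContinuousLinearMap.star_eq_adjoint, ContinuousLinearMap.adjoint_inner_left]
    simp [bergmanMatrix, bergmanKernel_conj, mul_comm]
  · refine (Complex.le_def.1 (isPosKernel_bergmanKernel hl v.support v)).1.trans_eq ?_
    simp only [Finsupp.sum]
    congr 1
    refine Finset.sum_congr rfl fun x _ => Finset.sum_congr rfl fun y _ => ?_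
    simp [bergmanMatrix, bergmanKernel_conj]
    ring

/-- An operator on a reproducing kernel Hilbert space of scalar functions given by
composition followed by multiplication exists once it is bounded on the kernel functions. -/
theorem exists_weightedComposition {X H : Type*} [NormedAddCommGroup H] [InnerProductSpace ℂ H]
    [CompleteSpace H] [RKHS ℂ H X ℂ] (φ : X → ℂ) (τ : X → X) (C : ℝ)
    (h : ∀ (s : Finset X) (a : X → ℂ), ‖∑ x ∈ s, RKHS.kerFun H (τ x) (conj (φ x) * a x)‖ ≤
      C * ‖∑ x ∈ s, RKHS.kerFun H x (a x)‖) :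
    ∃ T : H →L[ℂ] H, ∀ f x, T f x = φ x * f (τ x) := by
  let e : (X →₀ ℂ) →ₗ[ℂ] H := Finsupp.lsum ℂ fun x => (RKHS.kerFun H x).toLinearMap
  let g : (X →₀ ℂ) →ₗ[ℂ] H :=
    Finsupp.lsum ℂ fun x => (conj (φ x)) • (RKHS.kerFun H (τ x)).toLinearMap
  have he : DenseRange e := by
    have h1 := RKHS.kerFun_dense H
    rw [← Submodule.dense_iff_topologicalClosure_eq_top] at h1
    refine h1.mono ?_
    change _ ⊆ ((LinearMap.range e : Submodule ℂ H) : Set H)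
    rw [SetLike.coe_subset_coe, Submodule.span_le]
    rintro _ ⟨x, v, rfl⟩
    exact ⟨Finsupp.single x v, by simp [e]⟩
  have hb : ∀ v, ‖g v‖ ≤ C * ‖e v‖ := by
    intro v
    have h2 := h v.support v
    simp only [← smul_eq_mul, map_smul] at h2
    simpa [g, e, Finsupp.sum] using h2
  let S : H →L[ℂ] H := g.extendOfNorm e
  have hS : ∀ x, S (RKHS.kerFun H x 1) = conj (φ x) • RKHS.kerFun H (τ x) 1 := by
    intro x
    have := LinearMap.extendOfNorm_eq he ⟨C, hb⟩ (Finsupp.single x 1)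
    simpa [e, g] using this
  refine ⟨ContinuousLinearMap.adjoint S, fun f x => ?_⟩
  have h1 := RKHS.kerFun_inner (H := H) x (1 : ℂ) (ContinuousLinearMap.adjoint S f)
  rw [ContinuousLinearMap.adjoint_inner_right, hS, inner_smul_left, RKHS.kerFun_inner] at h1
  simpa using h1.symm


instance bergmanMatrix_fact (n : ℕ) (l : ℝ) [hl : Fact (0 < l)] :
    Fact (bergmanMatrix n l).PosSemidef := ⟨bergmanMatrix_posSemidef n hl.out⟩

/-- The weighted Bergman space of the polydisc, of weight `l > 0`: the Hilbert space of functions on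
the polydisc with reproducing kernel `bergmanKernel n l`. -/
abbrev BergmanSpace (n : ℕ) (l : ℝ) [Fact (0 < l)] : Type := RKHS.OfKernel (bergmanMatrix n l)

section operators

variable {n : ℕ} {l : ℝ} [hl : Fact (0 < l)]

theorem norm_sq_sum_kerFun (s : Finset (polydisc n)) (τ : polydisc n → polydisc n)
    (a : polydisc n → ℂ) :
    ((‖∑ x ∈ s, RKHS.kerFun (BergmanSpace n l) (τ x) (a x)‖ ^ 2 : ℝ) : ℂ) =
      ∑ x ∈ s, ∑ y ∈ s, conj (a x) * bergmanKernel n l (τ x) (τ y) * a y := by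
  have h := inner_self_eq_norm_sq_to_K (𝕜 := ℂ) (∑ x ∈ s, RKHS.kerFun (BergmanSpace n l) (τ x) (a x))
  push_cast
  refine h.symm.trans ?_
  rw [sum_inner]
  refine Finset.sum_congr rfl fun x _ => ?_
  rw [inner_sum]
  refine Finset.sum_congr rfl fun y _ => ?_
  rw [RKHS.kerFun_inner, RKHS.kerFun_apply, RKHS.OfKernel.kernel_ofKernel]
  simp [bergmanMatrix]
  ring

/-- `(σ · z)_i = z_(σ⁻¹ i)`. -/
def permAct (σ : Equiv.Perm (Fin n)) (z : polydisc n) : polydisc n :=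
  ⟨fun i => z.1 (σ⁻¹ i), fun _ => z.2 _⟩

theorem exists_permOp (σ : Equiv.Perm (Fin n)) :
    ∃ R : BergmanSpace n l →L[ℂ] BergmanSpace n l, ∀ f z, R f z = f (permAct σ⁻¹ z) := by
  obtain ⟨R, hR⟩ := exists_weightedComposition (H := BergmanSpace n l) (fun _ => 1)
    (permAct σ⁻¹) 1 (by
      intro s a
      have h1 := norm_sq_sum_kerFun (l := l) s (permAct σ⁻¹) a
      have h2 := norm_sq_sum_kerFun (l := l) s id a
      have e (x y : polydisc n) :
          bergmanKernel n l (permAct σ⁻¹ x) (permAct σ⁻¹ y) = bergmanKernel n l x y :=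
        Equiv.prod_comp (σ⁻¹)⁻¹ fun j => (1 - x.1 j * conj (y.1 j)) ^ (-(l : ℂ))
      simp only [e] at h1
      simp only [id] at h2
      have h3 := Complex.ofReal_injective (h1.trans h2.symm)
      simp only [map_one, one_mul]
      exact ((sq_eq_sq₀ (norm_nonneg _) (norm_nonneg _)).1 h3).le)
  exact ⟨R, by simpa using hR⟩

/-- The operator `R_σ f = f ∘ σ⁻¹`. -/
noncomputable def permOp (σ : Equiv.Perm (Fin n)) : BergmanSpace n l →L[ℂ] BergmanSpace n l :=
  (exists_permOp σ).choose

theorem permOp_apply (σ : Equiv.Perm (Fin n)) (f : BergmanSpace n l) (z : polydisc n) :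
    permOp σ f z = f (permAct σ⁻¹ z) := (exists_permOp σ).choose_spec f z

theorem exists_coordOp (i : Fin n) :
    ∃ M : BergmanSpace n l →L[ℂ] BergmanSpace n l, ∀ f z, M f z = z.1 i * f z := by
  refine exists_weightedComposition (H := BergmanSpace n l) (fun z => z.1 i) id
    (√(max 1 l⁻¹)) ?_
  intro s a
  have hC : (0 : ℝ) ≤ max 1 l⁻¹ := zero_le_one.trans (le_max_left _ _)
  refine le_of_sq_le_sq ?_ (by positivity)
  rw [mul_pow, Real.sq_sqrt hC, ← sub_nonneg, ← Complex.zero_le_real]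
  have h1 := norm_sq_sum_kerFun (l := l) s id fun x => conj (x.1 i) * a x
  have h2 := norm_sq_sum_kerFun (l := l) s id a
  rw [Complex.ofReal_sub, Complex.ofReal_mul]
  simp only [id] at h1 h2 ⊢
  rw [h1, h2]
  refine (isPosKernel_shift (n := n) hl.out i s a).trans_eq ?_
  rw [Finset.mul_sum, ← Finset.sum_sub_distrib]
  refine Finset.sum_congr rfl fun x _ => ?_
  rw [Finset.mul_sum, ← Finset.sum_sub_distrib]
  refine Finset.sum_congr rfl fun y _ => ?_
  simp
  ring

theorem exists_mulOp (p : MvPolynomial (Fin n) ℂ) :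
    ∃ M : BergmanSpace n l →L[ℂ] BergmanSpace n l,
      ∀ f z, M f z = MvPolynomial.eval z.1 p * f z := by
  induction p using MvPolynomial.induction_on with
  | C a => exact ⟨a • ContinuousLinearMap.id ℂ _, fun f z => by simp⟩
  | add p q hp hq =>
    obtain ⟨P, hP⟩ := hp
    obtain ⟨Q, hQ⟩ := hq
    exact ⟨P + Q, fun f z => by simp [hP, hQ, add_mul]⟩
  | mul_X p _ hp =>
    obtain ⟨P, hP⟩ := hp
    obtain ⟨M, hM⟩ := exists_coordOp (l := l) ‹_›
    exact ⟨P.comp M, fun f z => by simp [hP, hM, mul_assoc]⟩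

/-- Pointwise multiplication by a polynomial, as a bounded operator. -/
noncomputable def mulOp (p : MvPolynomial (Fin n) ℂ) : BergmanSpace n l →L[ℂ] BergmanSpace n l :=
  (exists_mulOp p).choose

theorem mulOp_apply (p : MvPolynomial (Fin n) ℂ) (f : BergmanSpace n l) (z : polydisc n) :
    mulOp p f z = MvPolynomial.eval z.1 p * f z := (exists_mulOp p).choose_spec f z

end operators


/-! ### Young diagrams, Young symmetrizers and characters of the symmetric group -/

/-- The Young diagram of a partition: the rows are the parts in decreasing order. -/
def diagram {n : ℕ} (p : n.Partition) : YoungDiagram :=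
  YoungDiagram.ofRowLens (p.parts.sort (· ≥ ·)) (Multiset.pairwise_sort _ _).sortedGE

theorem card_cellsOfRowLens (w : List ℕ) : (YoungDiagram.cellsOfRowLens w).card = w.sum := by
  induction w with
  | nil => rfl
  | cons a w ih =>
    rw [YoungDiagram.cellsOfRowLens, Finset.card_union_of_disjoint]
    · simp [ih]
    · rw [Finset.disjoint_left]
      rintro ⟨x, y⟩ h1 h2
      simp at h1 h2
      omega

theorem card_diagram {n : ℕ} (p : n.Partition) : (diagram p).card = n := by
  have h := card_cellsOfRowLens (p.parts.sort (· ≥ ·))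
  rw [← Multiset.sum_coe, Multiset.sort_eq, p.parts_sum] at h
  exact h

/-- A tableau of shape `p`: a numbering of the cells of the diagram of `p` by `Fin n`. -/
abbrev Tableau {n : ℕ} (p : n.Partition) : Type := Fin n ≃ (diagram p).cells

instance {n : ℕ} (p : n.Partition) : Nonempty (Tableau p) :=
  ⟨(Finset.equivFinOfCardEq (card_diagram p)).symm⟩

section young

variable {n : ℕ} {p : n.Partition} (T : Tableau p)

/-- Row of the entry `i` in the tableau. -/
def Tableau.row (i : Fin n) : ℕ := (T i).1.1

/-- Column of the entry `i` in the tableau. -/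
def Tableau.col (i : Fin n) : ℕ := (T i).1.2

open Classical in
/-- The Young symmetrizer `(∑ g) * (∑ sgn(h) h)` in the group algebra, with `g` running over the
permutations preserving each row of `T`, and `h` over those preserving each column. -/
noncomputable def youngSymmetrizer : MonoidAlgebra ℂ (Equiv.Perm (Fin n)) :=
  (∑ g : Equiv.Perm (Fin n) with ∀ i, T.row (g i) = T.row i, MonoidAlgebra.single g 1) *
  (∑ h : Equiv.Perm (Fin n) with ∀ i, T.col (h i) = T.col i,
    MonoidAlgebra.single h ((Equiv.Perm.sign h : ℤ) : ℂ))

/-- The irreducible representation attached to `p`: the left ideal of the group algebra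
generated by the Young symmetrizer. -/
noncomputable abbrev youngModule :
    Submodule (MonoidAlgebra ℂ (Equiv.Perm (Fin n))) (MonoidAlgebra ℂ (Equiv.Perm (Fin n))) :=
  Submodule.span _ {youngSymmetrizer T}

/-- The action of the symmetric group on `youngModule T` by left multiplication. -/
noncomputable def youngRep : Representation ℂ (Equiv.Perm (Fin n)) (youngModule T) :=
  Representation.ofModule' (youngModule T)

/-- The character `χ_p` of the irreducible representation attached to `p`. It does not depend on the
numbering `T`, since renumbering conjugates the Young symmetrizer. -/
noncomputable def youngChar (σ : Equiv.Perm (Fin n)) : ℂ := (youngRep T).character σ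

/-- The degree `χ_p(1)` of the character, that is, the dimension of the representation. -/
noncomputable def youngDegree : ℕ := Module.finrank ℂ (youngModule T)

theorem youngChar_one : youngChar T 1 = youngDegree T := by
  simp [youngChar, youngDegree, Representation.character]

end young

/-! ### The isotypic submodules -/

section isotypic

variable {n : ℕ} (l : ℝ) [hl : Fact (0 < l)] {p : n.Partition} (T : Tableau p)

/-- The isotypic projection `P_p f = χ_p(1) / n! * ∑ σ, conj (χ_p σ) • (f ∘ σ⁻¹)`. -/
noncomputable def isotypicProj : BergmanSpace n l →L[ℂ] BergmanSpace n l :=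
  (youngChar T 1 / (n.factorial : ℂ)) •
    ∑ σ : Equiv.Perm (Fin n), conj (youngChar T σ) • permOp σ

/-- The isotypic submodule: the image of `P_p` on the weighted Bergman space. -/
noncomputable def isotypic : Submodule ℂ (BergmanSpace n l) :=
  LinearMap.range (isotypicProj l T).toLinearMap

theorem mulOp_permOp {q : MvPolynomial (Fin n) ℂ} (hq : q.IsSymmetric) (σ : Equiv.Perm (Fin n))
    (f : BergmanSpace n l) : mulOp q (permOp σ f) = permOp σ (mulOp q f) := by
  refine RKHS.ext fun z => ?_
  rw [mulOp_apply, permOp_apply, permOp_apply, mulOp_apply]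
  congr 1
  conv_lhs => rw [← hq (σ⁻¹)⁻¹]
  rw [MvPolynomial.eval_rename]
  rfl

theorem mulOp_isotypicProj {q : MvPolynomial (Fin n) ℂ} (hq : q.IsSymmetric)
    (f : BergmanSpace n l) : mulOp q (isotypicProj l T f) = isotypicProj l T (mulOp q f) := by
  simp [isotypicProj, mulOp_permOp l hq]

theorem mulOp_mem_isotypic {q : MvPolynomial (Fin n) ℂ} (hq : q.IsSymmetric)
    {f : BergmanSpace n l} (hf : f ∈ isotypic l T) : mulOp q f ∈ isotypic l T := by
  obtain ⟨g, rfl⟩ := hf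
  exact ⟨mulOp q g, (mulOp_isotypicProj l T hq g).symm⟩

/-- The Hilbert module structure of the isotypic submodule over the ring of symmetric polynomials, by pointwise multiplication. -/
noncomputable def symmetricModule :
    MvPolynomial.symmetricSubalgebra (Fin n) ℂ →ₐ[ℂ] (isotypic l T →L[ℂ] isotypic l T) where
  toFun q := ((mulOp q.1).comp (isotypic l T).subtypeL).codRestrict (isotypic l T)
    fun f => mulOp_mem_isotypic l T q.2 f.2
  map_one' := by
    ext f : 2
    exact RKHS.ext fun z => by simp [mulOp_apply]
  map_mul' q r := by
    ext f : 2
    refine RKHS.ext fun z => ?_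
    change mulOp (q.1 * r.1) f.1 z = mulOp q.1 (mulOp r.1 f.1) z
    simp [mulOp_apply, mul_assoc]
  map_zero' := by
    ext f : 2
    exact RKHS.ext fun z => by simp [mulOp_apply]
  map_add' q r := by
    ext f : 2
    refine RKHS.ext fun z => ?_
    change mulOp (q.1 + r.1) f.1 z = (mulOp q.1 f.1 + mulOp r.1 f.1 : BergmanSpace n l) z
    simp [mulOp_apply, add_mul]
  commutes' c := by
    ext f : 2
    exact RKHS.ext fun z => by simp [mulOp_apply, Algebra.algebraMap_eq_smul_one]

/-- The same module, over the polynomial ring in `n` variables, through the isomorphism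
sending the variables to the elementary symmetric polynomials. -/
noncomputable def isotypicModule :
    MvPolynomial (Fin n) ℂ →ₐ[ℂ] (isotypic l T →L[ℂ] isotypic l T) :=
  (symmetricModule l T).comp
    (MvPolynomial.esymmAlgEquiv (Fin n) ℂ (Fintype.card_fin n)).toAlgHom

end isotypic

/-! ### Local freeness -/

section locallyFree

variable {n : ℕ} {H : Type*} [NormedAddCommGroup H] [InnerProductSpace ℂ H]

/-- The module tensor product of the Hilbert module `H` over the polynomial ring (`M q` being the
bounded operator by which `q` acts) with the one-dimensional module at `w`, on which `q` acts as
the scalar `q(w)`: the quotient of `H` by the closed span of the vectors `(q - q(w)) f`, realized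
as the orthogonal complement of these vectors. -/
noncomputable def moduleTensor (M : MvPolynomial (Fin n) ℂ →ₐ[ℂ] (H →L[ℂ] H)) (w : Fin n → ℂ) :
    Submodule ℂ H :=
  (Submodule.span ℂ {g | ∃ q f, g = M (q - MvPolynomial.C (MvPolynomial.eval w q)) f})ᗮ

/-- `H` is locally free of rank `k` at `w`: on a neighbourhood `U` of `w` there are `k` holomorphic
`H`-valued functions whose values at each `z` in `U` form a basis of the module tensor product
at the point `star z`, the coordinatewise complex conjugate of `z`. -/
def IsLocallyFreeAt (M : MvPolynomial (Fin n) ℂ →ₐ[ℂ] (H →L[ℂ] H)) (k : ℕ)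
    (w : Fin n → ℂ) : Prop :=
  ∃ U : Set (Fin n → ℂ), IsOpen U ∧ w ∈ U ∧ ∃ γ : Fin k → (Fin n → ℂ) → H,
    (∀ j, DifferentiableOn ℂ (γ j) U) ∧
    ∀ z ∈ U, LinearIndependent ℂ (fun j => γ j z) ∧
      Submodule.span ℂ (Set.range fun j => γ j z) = moduleTensor M (star z)

/-- `H` is locally free of rank `k` on `Ω`: it is so at every `w` in `Ω* = {w | star w ∈ Ω}`. -/
def IsLocallyFreeOn (M : MvPolynomial (Fin n) ℂ →ₐ[ℂ] (H →L[ℂ] H)) (k : ℕ)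
    (Ω : Set (Fin n → ℂ)) : Prop :=
  ∀ w, star w ∈ Ω → IsLocallyFreeAt M k w

end locallyFree

/-- The symmetrization map `s = (s_1, ..., s_n)` given by the elementary symmetric polynomials. -/
noncomputable def symmetrization (n : ℕ) (z : Fin n → ℂ) : Fin n → ℂ :=
  fun k => MvPolynomial.eval z (MvPolynomial.esymm (Fin n) ℂ (k + 1))

/-- The points of the polydisc with two equal coordinates. -/
def diagonalLocus (n : ℕ) : Set (Fin n → ℂ) := {z ∈ polydisc n | ∃ i j, i ≠ j ∧ z i = z j}

/-- The symmetrized polydisc. -/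
def symmetrizedPolydisc (n : ℕ) : Set (Fin n → ℂ) := symmetrization n '' polydisc n

theorem isotypicModule_apply {n : ℕ} (l : ℝ) [Fact (0 < l)] {p : n.Partition} (T : Tableau p)
    (q : MvPolynomial (Fin n) ℂ) (f : isotypic l T) (z : polydisc n) :
    (isotypicModule l T q f : BergmanSpace n l) z =
      MvPolynomial.eval (symmetrization n z) q * (f : BergmanSpace n l) z := by
  change mulOp _ f.1 z = _
  rw [mulOp_apply]
  congr 1
  have h : ((MvPolynomial.aeval z.1).comp (MvPolynomial.symmetricSubalgebra (Fin n) ℂ).val).comp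
      (MvPolynomial.esymmAlgHom (Fin n) ℂ n) =
      MvPolynomial.aeval (R := ℂ) (symmetrization n z.1) := by
    refine MvPolynomial.algHom_ext fun i => ?_
    simp [MvPolynomial.esymmAlgHom, symmetrization]
  simpa using congrArg (fun φ => φ q) h

end BergmanPolydisc

/-!
The argument has an algebraic half, on the group algebra `A` of the symmetric group, and an analytic
half, on the kernel functions `k_b = K(·, b)`.

Let `c` be the Young symmetrizer of the tableau. A combinatorial lemma on tableaux
(`Tableau.exists_factorization`) shows that `c x c` is a multiple of `c` for every `x` in `A`
(`youngSymmetrizer_mul_mul`); in particular `c * c = κ • c`, and `κ ≠ 0` by a trace computation.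
Since `x ↦ x c / κ` projects `A` onto the left ideal `A c`, the character is
`χ(τ) = κ⁻¹ ∑ g, c(g⁻¹ τ⁻¹ g)`. Hence the element `ε = χ(1) / n! * ∑ σ, conj (χ(σ)) σ` is a multiple
of the central element `∑ g, g c g⁻¹`, which acts on `A c` as a scalar, and `ε` is a central
idempotent. Its ideal `ε A` has dimension `n! * ε(1) = χ(1) ^ 2`, the trace of multiplication by `ε`
(`finrank_range_mulLeft_centralIdem`). The isotypic projection is the operator by which `ε` acts on
the Bergman space: it is a self-adjoint idempotent, so its range is closed, hence complete.

Let `b` be a point of the polydisc with distinct coordinates. The polynomials vanishing on the orbit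
of `b` form the ideal generated by the functions `s_k - s_k(b)`; this is proved in the explicit form
of an interpolation formula on the orbit (`sub_sum_orbitBasis_mem`). As polynomials are dense, an
element of the module tensor product at `s(b)` is therefore a combination of the kernel functions
`k_{σ b}`, which are linearly independent. So `x ↦ ∑ σ, x(σ) k_{σ b}` is injective on `A` and maps
`ε A` onto the module tensor product, which has the dimension claimed.

A basis of `ε A` does not depend on `b`, so it gives a frame of the module tensor products that
varies with `b` only through the kernel functions. These depend holomorphically on `conj b`
(`exists_holomorphic_kernel`: apply to the constant `1` the operators of multiplication by
`(1 - z_i t) ^ (-l)`, which are power series in `t`), and `conj b` is a holomorphic function of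
`conj (s(b))`, because the symmetrization map has real coefficients and is locally invertible at
points with distinct coordinates (`exists_local_section`).
-/

namespace BergmanPolydisc

open MonoidAlgebra (single)

/-! ### Combinatorics of tableaux -/

/-- Among the sets of `m` natural numbers, `range m` has the least sum, and is the only one
attaining it: every element outside `range m` costs at least one. -/
theorem sum_range_card_add_card_sdiff_le (F : Finset ℕ) :
    ∑ i ∈ Finset.range F.card, i + (F \ Finset.range F.card).card ≤ ∑ i ∈ F, i := by
  classical
  set R := Finset.range F.card with hR
  have hcard : (F \ R).card = (R \ F).card :=
    Finset.card_sdiff_comm (by simp [hR])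
  have h1 : ∑ i ∈ F ∩ R, i + ∑ i ∈ F \ R, i = ∑ i ∈ F, i :=
    Finset.sum_inter_add_sum_sdiff F R _
  have h2 : ∑ i ∈ R ∩ F, i + ∑ i ∈ R \ F, i = ∑ i ∈ R, i :=
    Finset.sum_inter_add_sum_sdiff R F _
  have h3 : (F \ R).card • F.card ≤ ∑ i ∈ F \ R, i :=
    Finset.card_nsmul_le_sum _ _ _ fun x hx => by
      simpa [hR] using (Finset.mem_sdiff.1 hx).2
  have h4 : ∑ i ∈ R \ F, (i + 1) ≤ (R \ F).card • F.card :=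
    Finset.sum_le_card_nsmul _ _ _ fun x hx => by
      have := (Finset.mem_sdiff.1 hx).1
      rw [hR, Finset.mem_range] at this
      omega
  rw [Finset.sum_add_distrib, Finset.sum_const, smul_eq_mul, mul_one, ← hcard] at h4
  rw [Finset.inter_comm] at h2
  omega

section young

variable {n : ℕ} {p : n.Partition} (T : Tableau p)

theorem Tableau.mem_diagram (i : Fin n) : (T.row i, T.col i) ∈ diagram p := (T i).2

theorem Tableau.eq_of_row_eq_of_col_eq {i j : Fin n} (h1 : T.row i = T.row j)
    (h2 : T.col i = T.col j) : i = j :=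
  T.injective (Subtype.ext (Prod.ext h1 h2))

theorem Tableau.exists_of_mem {x y : ℕ} (h : (x, y) ∈ diagram p) :
    ∃ i, T.row i = x ∧ T.col i = y :=
  ⟨T.symm ⟨(x, y), h⟩, by simp [Tableau.row], by simp [Tableau.col]⟩

open Classical in
theorem Tableau.image_row_column (c : ℕ) :
    (Finset.univ.filter fun j => T.col j = c).image T.row =
      Finset.range ((diagram p).colLen c) := by
  ext x
  simp only [Finset.mem_image, Finset.mem_filter, Finset.mem_univ, true_and, Finset.mem_range,
    ← YoungDiagram.mem_iff_lt_colLen]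
  constructor
  · rintro ⟨j, rfl, rfl⟩
    exact T.mem_diagram j
  · intro h
    obtain ⟨i, h1, h2⟩ := T.exists_of_mem h
    exact ⟨i, h2, h1⟩

open Classical in
/-- If a rearrangement `g` of a tableau separates the entries of each row into distinct columns,
then every entry `j` finds, within its own row, a cell of the diagram in its new column. -/
theorem Tableau.mem_diagram_of_separates (g : Equiv.Perm (Fin n))
    (h : ∀ i j, i ≠ j → T.row i = T.row j → T.col (g⁻¹ i) ≠ T.col (g⁻¹ j)) (j : Fin n) :
    (T.row j, T.col (g⁻¹ j)) ∈ diagram p := by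
  let A (c : ℕ) : Finset (Fin n) := Finset.univ.filter fun j => T.col j = c
  let B (c : ℕ) : Finset (Fin n) := Finset.univ.filter fun j => T.col (g⁻¹ j) = c
  have hAinj (c : ℕ) : Set.InjOn T.row (A c) := fun x hx y hy hxy =>
    T.eq_of_row_eq_of_col_eq hxy (by
      simp only [A, Finset.coe_filter, Set.mem_ofPred_eq] at hx hy; rw [hx.2, hy.2])
  have hBinj (c : ℕ) : Set.InjOn T.row (B c) := fun x hx y hy hxy => by
    by_contra hne
    simp only [B, Finset.coe_filter, Set.mem_ofPred_eq] at hx hy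
    exact h x y hne hxy (hx.2.trans hy.2.symm)
  have hBA (c : ℕ) : B c = (A c).map g.toEmbedding := by
    ext x
    simp [A, B, Equiv.Perm.inv_def]
  have hcA (c : ℕ) : (A c).card = (diagram p).colLen c := by
    rw [← Finset.card_image_of_injOn (hAinj c), T.image_row_column, Finset.card_range]
  have hcB (c : ℕ) : ((B c).image T.row).card = (diagram p).colLen c := by
    rw [Finset.card_image_of_injOn (hBinj c), hBA, Finset.card_map, hcA]
  have hsA (c : ℕ) : ∑ j ∈ A c, T.row j = ∑ i ∈ Finset.range ((diagram p).colLen c), i := by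
    rw [← T.image_row_column c, Finset.sum_image (hAinj c)]
  have hle (c : ℕ) := sum_range_card_add_card_sdiff_le ((B c).image T.row)
  simp only [hcB, ← hsA] at hle
  simp only [Finset.sum_image (hBinj _)] at hle
  -- Both sides below are the sum of all row indices, so each column inequality is an equality.
  let S : Finset ℕ := Finset.univ.image T.col
  have e1 : ∑ c ∈ S, ∑ j ∈ A c, T.row j = ∑ j, T.row j :=
    Finset.sum_fiberwise_of_maps_to (fun x _ => Finset.mem_image_of_mem _ (Finset.mem_univ _)) _
  have e2 : ∑ c ∈ S, ∑ j ∈ B c, T.row j = ∑ j, T.row j :=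
    Finset.sum_fiberwise_of_maps_to (fun x _ => Finset.mem_image_of_mem _ (Finset.mem_univ _)) _
  have e3 := (Finset.sum_eq_sum_iff_of_le (s := S)
    fun c _ => (Nat.le_add_right _ _).trans (hle c)).1 (e1.trans e2.symm)
  have hj := hle (T.col (g⁻¹ j))
  rw [e3 _ (Finset.mem_image_of_mem _ (Finset.mem_univ _)), add_le_iff_nonpos_right,
    Nat.le_zero, Finset.card_eq_zero, Finset.sdiff_eq_empty_iff_subset] at hj
  rw [YoungDiagram.mem_iff_lt_colLen, ← Finset.mem_range]
  exact hj (Finset.mem_image_of_mem _ (by simp [B]))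

/-- A permutation that separates the entries of each row into distinct columns is the product of
a row permutation and a column permutation. -/
theorem Tableau.exists_factorization (g : Equiv.Perm (Fin n))
    (h : ∀ i j, i ≠ j → T.row i = T.row j → T.col (g⁻¹ i) ≠ T.col (g⁻¹ j)) :
    ∃ r q : Equiv.Perm (Fin n), (∀ i, T.row (r i) = T.row i) ∧ (∀ i, T.col (q i) = T.col i) ∧
      g = r * q := by
  choose u hu1 hu2 using fun j => T.exists_of_mem (T.mem_diagram_of_separates g h j)
  have hinj : Function.Injective u := by
    intro i j hij
    by_contra hne
    refine h i j hne ?_ ?_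
    · rw [← hu1 i, ← hu1 j, hij]
    · rw [← hu2 i, ← hu2 j, hij]
  let v : Equiv.Perm (Fin n) := Equiv.ofBijective u (Finite.injective_iff_bijective.1 hinj)
  have hv1 (j) : T.row (v j) = T.row j := hu1 j
  have hv2 (j) : T.col (v j) = T.col (g⁻¹ j) := hu2 j
  refine ⟨v⁻¹, v * g, fun i => ?_, fun i => ?_, by group⟩
  · rw [← hv1 (v⁻¹ i)]; simp
  · rw [Equiv.Perm.mul_apply, hv2]; simp

/-! ### The Young symmetrizer -/

theorem single_mul_youngSymmetrizer (r : Equiv.Perm (Fin n)) (hr : ∀ i, T.row (r i) = T.row i) :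
    single r (1 : ℂ) * youngSymmetrizer T = youngSymmetrizer T := by
  classical
  unfold youngSymmetrizer
  rw [← mul_assoc]
  congr 1
  rw [Finset.mul_sum]
  refine Finset.sum_bijective (fun g => r * g) (Group.mulLeft_bijective r) (fun g => ?_)
    (fun g _ => by simp)
  simp [hr]

theorem youngSymmetrizer_mul_single (q : Equiv.Perm (Fin n)) (hq : ∀ i, T.col (q i) = T.col i) :
    youngSymmetrizer T * single q (1 : ℂ) =
      ((Equiv.Perm.sign q : ℤ) : ℂ) • youngSymmetrizer T := by
  classical
  unfold youngSymmetrizer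
  rw [mul_assoc, ← mul_smul_comm]
  congr 1
  rw [Finset.sum_mul, Finset.smul_sum]
  refine Finset.sum_bijective (fun g => g * q) (Group.mulRight_bijective q) (fun g => ?_)
    (fun g _ => ?_)
  · simp only [Finset.mem_filter, Finset.mem_univ, true_and, Equiv.Perm.mul_apply]
    constructor
    · intro h i; rw [h, hq]
    · intro h i
      obtain ⟨j, rfl⟩ := q.surjective i
      rw [h, hq]
  · have : ((Equiv.Perm.sign q : ℤ) : ℂ) * (Equiv.Perm.sign q : ℤ) = 1 := by
      rw [← Int.cast_mul, ← Units.val_mul, ← sq, Int.units_sq]; simp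
    simp [mul_comm (_ : ℂ), ← mul_assoc, this]

theorem coeff_youngSymmetrizer_one : (youngSymmetrizer T).coeff 1 = 1 := by
  classical
  unfold youngSymmetrizer
  rw [Finset.sum_mul, MonoidAlgebra.coeff_sum, Finset.sum_apply']
  rw [Finset.sum_eq_single 1]
  · rw [← MonoidAlgebra.one_def, one_mul, MonoidAlgebra.coeff_sum, Finset.sum_apply',
      Finset.sum_eq_single 1]
    · simp
    · intro b _ hb
      simp [hb]
    · simp
  · intro b hb hb1
    simp only [Finset.mem_filter, Finset.mem_univ, true_and] at hb
    rw [MonoidAlgebra.coeff_single_mul_apply, MonoidAlgebra.coeff_sum, Finset.sum_apply',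
      Finset.sum_eq_zero, mul_zero]
    intro h hh
    simp only [Finset.mem_filter, Finset.mem_univ, true_and] at hh
    rw [MonoidAlgebra.coeff_single, Finsupp.single_apply, if_neg]
    rintro rfl
    refine hb1 (Equiv.ext fun i => (T.eq_of_row_eq_of_col_eq (hb i) ?_))
    have := hh (b i)
    rw [mul_one, ← Equiv.Perm.mul_apply, inv_mul_cancel] at this
    exact this.symm
  · simp

/-- Up to a scalar, the Young symmetrizer is the only element of the group algebra that is
invariant under row permutations on the left and alternating under column permutations on the
right: if two entries of a row of `T` lie in the same column after `g`, then exchanging them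
shows that the coefficient at `g` is its own negative. -/
theorem eq_smul_youngSymmetrizer (x : MonoidAlgebra ℂ (Equiv.Perm (Fin n)))
    (hl : ∀ r : Equiv.Perm (Fin n), (∀ i, T.row (r i) = T.row i) → single r (1 : ℂ) * x = x)
    (hr : ∀ q : Equiv.Perm (Fin n), (∀ i, T.col (q i) = T.col i) →
      x * single q (1 : ℂ) = ((Equiv.Perm.sign q : ℤ) : ℂ) • x) :
    x = x.coeff 1 • youngSymmetrizer T := by
  -- By linearity it suffices that such an element vanishes when its coefficient at `1` does.
  have key : ∀ y : MonoidAlgebra ℂ (Equiv.Perm (Fin n)),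
      (∀ r : Equiv.Perm (Fin n), (∀ i, T.row (r i) = T.row i) → single r (1 : ℂ) * y = y) →
      (∀ q : Equiv.Perm (Fin n), (∀ i, T.col (q i) = T.col i) →
        y * single q (1 : ℂ) = ((Equiv.Perm.sign q : ℤ) : ℂ) • y) → y.coeff 1 = 0 → y = 0 := by
    intro y hl hr h1
    have hl' : ∀ r g : Equiv.Perm (Fin n), (∀ i, T.row (r i) = T.row i) →
        y.coeff (r * g) = y.coeff g := by
      intro r g h
      have := congrArg (fun z => z.coeff (r * g)) (hl r h)
      simpa using this.symm
    have hr' : ∀ q g : Equiv.Perm (Fin n), (∀ i, T.col (q i) = T.col i) →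
        y.coeff g = ((Equiv.Perm.sign q : ℤ) : ℂ) * y.coeff (g * q) := by
      intro q g h
      have := congrArg (fun z => z.coeff (g * q)) (hr q h)
      simpa using this
    ext g
    rw [MonoidAlgebra.coeff_zero, Finsupp.zero_apply]
    by_cases h : ∀ i j, i ≠ j → T.row i = T.row j → T.col (g⁻¹ i) ≠ T.col (g⁻¹ j)
    · obtain ⟨r, q, hr1, hq1, rfl⟩ := T.exists_factorization g h
      have h2 := hr' q 1 hq1
      rw [h1, one_mul] at h2
      rw [hl' r q hr1]
      rcases Int.units_eq_one_or (Equiv.Perm.sign q) with h3 | h3 <;> simpa [h3] using h2.symm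
    · push Not at h
      obtain ⟨i, j, hij, hrow, hcol⟩ := h
      have h2 := hl' (Equiv.swap i j) g fun k => by
        rw [Equiv.swap_apply_def]
        split_ifs with ha hb
        · rw [ha, hrow]
        · rw [hb, hrow]
        · rfl
      have h3 := hr' (Equiv.swap (g⁻¹ i) (g⁻¹ j)) g fun k => by
        rw [Equiv.swap_apply_def]
        split_ifs with ha hb
        · rw [ha, hcol]
        · rw [hb, hcol]
        · rfl
      rw [Equiv.Perm.sign_swap (by simpa using hij), Equiv.mul_swap_eq_swap_mul] at h3
      rw [← Equiv.Perm.mul_apply, ← Equiv.Perm.mul_apply, mul_inv_cancel, Equiv.Perm.one_apply,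
        Equiv.Perm.one_apply, h2] at h3
      simp at h3
      linear_combination (1 / 2 : ℂ) * h3
  have := key (x - x.coeff 1 • youngSymmetrizer T)
    (fun r h => by rw [mul_sub, mul_smul_comm, hl r h, single_mul_youngSymmetrizer T r h])
    (fun q h => by
      rw [sub_mul, smul_mul_assoc, hr q h, youngSymmetrizer_mul_single T q h, smul_sub, smul_comm])
    (by simp [coeff_youngSymmetrizer_one])
  exact sub_eq_zero.1 this

theorem youngSymmetrizer_mul_mul (x : MonoidAlgebra ℂ (Equiv.Perm (Fin n))) :
    youngSymmetrizer T * x * youngSymmetrizer T =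
      (youngSymmetrizer T * x * youngSymmetrizer T).coeff 1 • youngSymmetrizer T :=
  eq_smul_youngSymmetrizer T _
    (fun r h => by rw [← mul_assoc, ← mul_assoc, single_mul_youngSymmetrizer T r h])
    (fun q h => by rw [mul_assoc, youngSymmetrizer_mul_single T q h, mul_smul_comm])

theorem coeff_youngSymmetrizer_real (g : Equiv.Perm (Fin n)) :
    conj ((youngSymmetrizer T).coeff g) = (youngSymmetrizer T).coeff g := by
  classical
  unfold youngSymmetrizer
  simp only [Finset.sum_mul_sum, MonoidAlgebra.single_mul_single, MonoidAlgebra.coeff_sum,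
    MonoidAlgebra.coeff_single, Finset.sum_apply', map_sum, Finsupp.single_apply]
  refine Finset.sum_congr rfl fun a _ => Finset.sum_congr rfl fun b _ => ?_
  split_ifs <;> simp

end young

/-! ### The character and the central idempotent -/

theorem single_eq_smul {G : Type*} (g : G) (a : ℂ) :
    (single g a : MonoidAlgebra ℂ G) = a • single g 1 := by
  rw [MonoidAlgebra.smul_single, smul_eq_mul, mul_one]

theorem trace_groupAlgebra {G : Type*} [Group G] [Fintype G]
    (φ : MonoidAlgebra ℂ G →ₗ[ℂ] MonoidAlgebra ℂ G) :
    LinearMap.trace ℂ _ φ = ∑ g, (φ (single g 1)).coeff g := by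
  classical
  rw [LinearMap.trace_eq_matrix_trace ℂ (MonoidAlgebra.basis G ℂ), Matrix.trace]
  refine Finset.sum_congr rfl fun g _ => ?_
  rw [Matrix.diag_apply, LinearMap.toMatrix_apply]
  simp
  rfl

section young

variable {n : ℕ} {p : n.Partition} (T : Tableau p)

/-- The scalar `κ` with `c * c = κ • c` for the Young symmetrizer `c`, read off as the coefficient of
`c * c` at the identity, where `c` has coefficient `1`. -/
noncomputable def hookProduct : ℂ := (youngSymmetrizer T * youngSymmetrizer T).coeff 1

theorem youngSymmetrizer_mul_self :
    youngSymmetrizer T * youngSymmetrizer T = hookProduct T • youngSymmetrizer T := by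
  simpa [hookProduct] using youngSymmetrizer_mul_mul T 1

/-- Right multiplication by the Young symmetrizer `c` has trace `n! * c(1) = n!`, so it is not
nilpotent. -/
theorem hookProduct_ne_zero : hookProduct T ≠ 0 := by
  intro h
  have h1 := youngSymmetrizer_mul_self T
  rw [h, zero_smul] at h1
  have h2 : IsNilpotent (LinearMap.mulRight ℂ (youngSymmetrizer T)) :=
    ⟨2, by ext; simp [sq, mul_assoc, h1]⟩
  have h3 := (LinearMap.isNilpotent_trace_of_isNilpotent h2).eq_zero
  rw [trace_groupAlgebra] at h3
  simp [coeff_youngSymmetrizer_one, Fintype.card_perm, Nat.factorial_ne_zero] at h3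

theorem conj_hookProduct : conj (hookProduct T) = hookProduct T := by
  rw [hookProduct, MonoidAlgebra.coeff_mul_apply_left, Finsupp.sum, map_sum]
  simp [coeff_youngSymmetrizer_real]

theorem mem_youngModule (x : MonoidAlgebra ℂ (Equiv.Perm (Fin n))) :
    x ∈ youngModule T ↔ x * youngSymmetrizer T = hookProduct T • x := by
  rw [Submodule.mem_span_singleton]
  constructor
  · rintro ⟨a, rfl⟩
    rw [smul_eq_mul, mul_assoc, youngSymmetrizer_mul_self, mul_smul_comm]
  · intro h
    refine ⟨(hookProduct T)⁻¹ • x, ?_⟩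
    rw [smul_eq_mul, smul_mul_assoc, h, inv_smul_smul₀ (hookProduct_ne_zero T)]

theorem coe_youngRep_apply (τ : Equiv.Perm (Fin n)) (x : youngModule T) :
    (youngRep T τ x).1 = single τ 1 * x.1 := rfl

/-- `κ * χ(τ)` is the trace of `x ↦ τ * x * c` on the whole group algebra, since right
multiplication by `c / κ` projects onto the left ideal generated by `c`. -/
theorem hookProduct_mul_youngChar (τ : Equiv.Perm (Fin n)) :
    hookProduct T * youngChar T τ = ∑ g, (youngSymmetrizer T).coeff (g⁻¹ * τ⁻¹ * g) := by
  let φ : MonoidAlgebra ℂ (Equiv.Perm (Fin n)) →ₗ[ℂ] MonoidAlgebra ℂ (Equiv.Perm (Fin n)) :=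
    (LinearMap.mulLeft ℂ (single τ 1)) ∘ₗ LinearMap.mulRight ℂ (youngSymmetrizer T)
  have hφ (x) : φ x = single τ 1 * (x * youngSymmetrizer T) := rfl
  have hmem (x) : φ x ∈ (youngModule T).restrictScalars ℂ := by
    rw [Submodule.restrictScalars_mem, hφ, ← mul_assoc]
    exact Submodule.smul_mem _ (_ * _) (Submodule.mem_span_singleton_self _)
  have h1 := LinearMap.trace_restrict_eq_of_forall_mem _ φ hmem
  let e : (youngModule T) ≃ₗ[ℂ] (youngModule T).restrictScalars ℂ :=
    (((youngModule T).restrictScalarsEquiv ℂ _ _).symm).restrictScalars ℂ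
  have h2 : φ.restrict (p := (youngModule T).restrictScalars ℂ) (fun x _ => hmem x) =
      e.conj (hookProduct T • youngRep T τ) := by
    refine LinearMap.ext fun x => Subtype.ext ?_
    have h3 : (e.conj (hookProduct T • youngRep T τ) x).1 =
        hookProduct T • (youngRep T τ (e.symm x)).1 := rfl
    rw [h3, coe_youngRep_apply, LinearMap.coe_restrict_apply, hφ, (mem_youngModule T x.1).1 x.2,
      mul_smul_comm]
    rfl
  rw [h2, LinearMap.trace_conj', map_smul, trace_groupAlgebra] at h1
  refine Eq.trans h1 (Finset.sum_congr rfl fun g _ => ?_)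
  rw [hφ]
  simp [mul_assoc]

theorem hookProduct_mul_youngDegree : hookProduct T * youngDegree T = n.factorial := by
  rw [← youngChar_one, hookProduct_mul_youngChar]
  simp [coeff_youngSymmetrizer_one, Fintype.card_perm]

theorem youngChar_inv (τ : Equiv.Perm (Fin n)) : youngChar T τ⁻¹ = youngChar T τ := by
  obtain ⟨g, hg⟩ := isConj_iff.1 ((Equiv.Perm.isConj_iff_cycleType_eq (σ := τ⁻¹) (τ := τ)).2
    (Equiv.Perm.cycleType_inv τ))
  calc youngChar T τ⁻¹ = youngChar T (g * τ⁻¹ * g⁻¹) := ((youngRep T).char_conj _ _).symm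
    _ = youngChar T τ := by rw [hg]

theorem conj_youngChar (τ : Equiv.Perm (Fin n)) : conj (youngChar T τ) = youngChar T τ := by
  have h := congrArg conj (hookProduct_mul_youngChar T τ)
  simp only [map_mul, map_sum, coeff_youngSymmetrizer_real, conj_hookProduct] at h
  rw [← hookProduct_mul_youngChar] at h
  exact mul_left_cancel₀ (hookProduct_ne_zero T) h

/-- The sum of all conjugates `g * c * g⁻¹` of the Young symmetrizer `c`, a central element. -/
noncomputable def conjSum : MonoidAlgebra ℂ (Equiv.Perm (Fin n)) :=
  ∑ g : Equiv.Perm (Fin n), single g 1 * youngSymmetrizer T * single g⁻¹ 1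

theorem conjSum_eq : conjSum T = ∑ σ, single σ (hookProduct T * youngChar T σ) := by
  ext τ
  simp only [conjSum, MonoidAlgebra.coeff_sum, Finset.sum_apply', MonoidAlgebra.coeff_single,
    Finsupp.single_apply, Finset.sum_ite_eq', Finset.mem_univ, if_true]
  rw [← youngChar_inv, hookProduct_mul_youngChar]
  simp [mul_assoc]

theorem single_mul_conjSum (g : Equiv.Perm (Fin n)) :
    single g 1 * conjSum T = conjSum T * single g 1 := by
  unfold conjSum
  rw [Finset.mul_sum, Finset.sum_mul]
  refine Finset.sum_bijective (fun h => g * h) (Group.mulLeft_bijective g) (fun h => by simp)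
    (fun h _ => ?_)
  simp only [← mul_assoc, MonoidAlgebra.single_mul_single, mul_one]
  rw [mul_assoc _ (single _ _) (single g 1), MonoidAlgebra.single_mul_single]
  simp

theorem mul_conjSum (x : MonoidAlgebra ℂ (Equiv.Perm (Fin n))) :
    x * conjSum T = conjSum T * x := by
  induction x using MonoidAlgebra.induction_linear with
  | zero => simp
  | add x y hx hy => rw [add_mul, mul_add, hx, hy]
  | single g a =>
    rw [single_eq_smul, smul_mul_assoc, mul_smul_comm, single_mul_conjSum]

/-- The central element `conjSum T` acts on the left ideal generated by the Young symmetrizer `c`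
as a scalar, because `c * x * c` is always a multiple of `c`; the coefficient at the identity
gives its value. -/
theorem conjSum_mul_youngSymmetrizer :
    conjSum T * youngSymmetrizer T = hookProduct T ^ 2 • youngSymmetrizer T := by
  set c := youngSymmetrizer T with hc
  set κ := hookProduct T
  have hk : κ ≠ 0 := hookProduct_ne_zero T
  have h1 : conjSum T * c = (conjSum T * c).coeff 1 • c := by
    have h2 := youngSymmetrizer_mul_mul T (conjSum T)
    rw [← hc, mul_conjSum, mul_assoc, hc, youngSymmetrizer_mul_self, mul_smul_comm,
      MonoidAlgebra.coeff_smul_apply, smul_assoc] at h2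
    exact smul_right_injective _ hk h2
  rw [h1]
  congr 1
  have h4 : (conjSum T * c).coeff 1 = ∑ g, (c * single g 1 * c).coeff 1 * c.coeff g := by
    unfold conjSum
    rw [Finset.sum_mul, MonoidAlgebra.coeff_sum, Finset.sum_apply',
      ← Equiv.sum_comp (Equiv.inv (Equiv.Perm (Fin n)))]
    refine Finset.sum_congr rfl fun g _ => ?_
    have h5 := youngSymmetrizer_mul_mul T (single g 1)
    rw [← hc] at h5 ⊢
    simp only [Equiv.inv_apply, inv_inv]
    rw [mul_assoc, mul_assoc, ← mul_assoc c, h5]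
    simp [hc, coeff_youngSymmetrizer_one]
  have h6 : c = ∑ g, single g (c.coeff g) := by
    ext h
    simp
  have h7 : (c * c * c).coeff 1 = κ ^ 2 := by
    rw [hc, youngSymmetrizer_mul_self, smul_mul_assoc, youngSymmetrizer_mul_self]
    simp [coeff_youngSymmetrizer_one, sq, κ]
  rw [h4, ← h7]
  have h8 : c * c * c = c * (∑ g, single g (c.coeff g)) * c := by rw [← h6]
  rw [h8]
  simp only [Finset.sum_mul, Finset.mul_sum, MonoidAlgebra.coeff_sum, Finset.sum_apply']
  refine Finset.sum_congr rfl fun g _ => ?_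
  rw [single_eq_smul g (c.coeff g), mul_smul_comm, smul_mul_assoc, MonoidAlgebra.coeff_smul_apply,
    smul_eq_mul, mul_comm]

theorem conjSum_mul_self : conjSum T * conjSum T = hookProduct T ^ 2 • conjSum T := by
  conv_lhs => enter [2]; rw [conjSum]
  rw [conjSum, Finset.mul_sum, Finset.smul_sum]
  refine Finset.sum_congr rfl fun g _ => ?_
  rw [← mul_assoc, ← mul_assoc]
  change conjSum T * _ * _ * _ = _
  rw [← mul_conjSum, mul_assoc (single g 1), conjSum_mul_youngSymmetrizer]
  simp

/-- The idempotent `χ(1) / n! * ∑ σ, conj (χ(σ)) σ` of the group algebra. -/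
noncomputable def centralIdem : MonoidAlgebra ℂ (Equiv.Perm (Fin n)) :=
  ∑ σ, single σ (youngChar T 1 / (n.factorial : ℂ) * conj (youngChar T σ))

theorem centralIdem_eq : centralIdem T = (hookProduct T ^ 2)⁻¹ • conjSum T := by
  have hk := hookProduct_ne_zero T
  have hd := hookProduct_mul_youngDegree T
  have hn : (n.factorial : ℂ) ≠ 0 := by exact_mod_cast n.factorial_ne_zero
  rw [conjSum_eq, Finset.smul_sum]
  refine Finset.sum_congr rfl fun σ _ => ?_
  rw [conj_youngChar, youngChar_one, MonoidAlgebra.smul_single, smul_eq_mul, ← hd]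
  rw [← hd] at hn
  congr 1
  field_simp [right_ne_zero_of_mul hn]

theorem isIdempotentElem_centralIdem : IsIdempotentElem (centralIdem T) := by
  have hk := hookProduct_ne_zero T
  rw [IsIdempotentElem, centralIdem_eq, smul_mul_smul_comm, conjSum_mul_self, smul_smul]
  congr 1
  field_simp

theorem coeff_centralIdem (σ : Equiv.Perm (Fin n)) :
    (centralIdem T).coeff σ = youngChar T 1 / (n.factorial : ℂ) * conj (youngChar T σ) := by
  simp [centralIdem, Finsupp.single_apply]

theorem coeff_centralIdem_inv (σ : Equiv.Perm (Fin n)) :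
    (centralIdem T).coeff σ⁻¹ = conj ((centralIdem T).coeff σ) := by
  simp [coeff_centralIdem, youngChar_inv, conj_youngChar]

/-- The rank of the idempotent operator "left multiplication by the central idempotent" is its
trace, which is `n!` times the coefficient at the identity. -/
theorem finrank_range_mulLeft_centralIdem :
    Module.finrank ℂ (LinearMap.range (LinearMap.mulLeft ℂ (centralIdem T))) =
      youngDegree T ^ 2 := by
  have h1 : IsIdempotentElem (LinearMap.mulLeft ℂ (centralIdem T)) := by
    rw [IsIdempotentElem, Module.End.mul_eq_comp, ← LinearMap.mulLeft_mul,
      (isIdempotentElem_centralIdem T).eq]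
  have h2 := (LinearMap.IsIdempotentElem.isProj_range _ h1).trace
  rw [trace_groupAlgebra] at h2
  have hn : (n.factorial : ℂ) ≠ 0 := by exact_mod_cast n.factorial_ne_zero
  have h3 : ((youngDegree T ^ 2 : ℕ) : ℂ) =
      Module.finrank ℂ (LinearMap.range (LinearMap.mulLeft ℂ (centralIdem T))) := by
    rw [← h2]
    simp [coeff_centralIdem, youngChar_one, Fintype.card_perm]
    field_simp
  exact_mod_cast h3.symm

end young

/-! ### The isotypic projection -/

section operators

variable {n : ℕ} {l : ℝ} [hl : Fact (0 < l)]

theorem permAct_mul (σ τ : Equiv.Perm (Fin n)) (z : polydisc n) :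
    permAct (σ * τ) z = permAct σ (permAct τ z) :=
  Subtype.ext (funext fun i => by simp [permAct])

variable (n l) in
/-- The reproducing kernel function `K(·, b)` of the point `b`. -/
noncomputable def kernelAt (b : polydisc n) : BergmanSpace n l :=
  RKHS.kerFun (BergmanSpace n l) b (1 : ℂ)

theorem inner_kernelAt (b : polydisc n) (f : BergmanSpace n l) :
    ⟪kernelAt n l b, f⟫_ℂ = f b := by
  simp [kernelAt, RKHS.kerFun_inner]

theorem kernelAt_apply (b z : polydisc n) : kernelAt n l b z = bergmanKernel n l z b := by
  rw [kernelAt, RKHS.kerFun_apply, RKHS.OfKernel.kernel_ofKernel]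
  simp [bergmanMatrix]

theorem permOp_kernelAt (σ : Equiv.Perm (Fin n)) (b : polydisc n) :
    permOp σ (kernelAt n l b) = kernelAt n l (permAct σ b) := by
  refine RKHS.ext fun z => ?_
  rw [permOp_apply, kernelAt_apply, kernelAt_apply, bergmanKernel, bergmanKernel]
  conv_rhs => rw [← Equiv.prod_comp σ]
  simp [permAct]

theorem eq_of_forall_kernelAt {H : Type*} [NormedAddCommGroup H] [NormedSpace ℂ H]
    {S S' : BergmanSpace n l →L[ℂ] H}
    (h : ∀ b, S (kernelAt n l b) = S' (kernelAt n l b)) : S = S' := by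
  refine ContinuousLinearMap.ext_on
    (s := {RKHS.kerFun (BergmanSpace n l) x v | (x) (v)}) ?_ ?_
  · rw [Submodule.dense_iff_topologicalClosure_eq_top]
    exact RKHS.kerFun_dense _
  · rintro _ ⟨x, v, rfl⟩
    rw [← mul_one v, ← smul_eq_mul, map_smul, map_smul, map_smul]
    exact congrArg (v • ·) (h x)

theorem adjoint_permOp (σ : Equiv.Perm (Fin n)) :
    ContinuousLinearMap.adjoint (permOp σ : BergmanSpace n l →L[ℂ] BergmanSpace n l) =
      permOp σ⁻¹ := by
  refine eq_of_forall_kernelAt fun b => RKHS.ext fun z => ?_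
  rw [← inner_kernelAt, ContinuousLinearMap.adjoint_inner_right, permOp_kernelAt, inner_kernelAt,
    permOp_apply, inv_inv]

variable (n l) in
/-- The representation of the group algebra on the weighted Bergman space. -/
noncomputable def permRep :
    MonoidAlgebra ℂ (Equiv.Perm (Fin n)) →ₐ[ℂ] (BergmanSpace n l →L[ℂ] BergmanSpace n l) :=
  MonoidAlgebra.lift ℂ _ _
    { toFun := permOp
      map_one' := by
        ext f z
        rw [permOp_apply]
        rfl
      map_mul' := fun σ τ => by
        ext f z
        change _ = permOp σ (permOp τ f) z
        rw [permOp_apply, permOp_apply, permOp_apply, mul_inv_rev, permAct_mul] }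

theorem permRep_apply (x : MonoidAlgebra ℂ (Equiv.Perm (Fin n))) :
    permRep n l x = ∑ σ, x.coeff σ • permOp σ := by
  rw [permRep, MonoidAlgebra.lift_apply, Finsupp.sum_fintype _ _ (by simp)]
  rfl

variable {p : n.Partition} (T : Tableau p)

theorem isotypicProj_eq : isotypicProj l T = permRep n l (centralIdem T) := by
  rw [permRep_apply, isotypicProj, Finset.smul_sum]
  exact Finset.sum_congr rfl fun σ _ => by rw [coeff_centralIdem, smul_smul]

theorem isotypicProj_isotypicProj (f : BergmanSpace n l) :
    isotypicProj l T (isotypicProj l T f) = isotypicProj l T f := by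
  rw [isotypicProj_eq, ← mul_apply_eq_comp, ← map_mul,
    (isIdempotentElem_centralIdem T).eq]

theorem mem_isotypic {f : BergmanSpace n l} : f ∈ isotypic l T ↔ isotypicProj l T f = f := by
  constructor
  · rintro ⟨g, rfl⟩
    exact isotypicProj_isotypicProj T g
  · intro h
    exact ⟨f, h⟩

theorem adjoint_isotypicProj :
    ContinuousLinearMap.adjoint (isotypicProj l T) = isotypicProj l T := by
  rw [isotypicProj_eq, permRep_apply, map_sum, ← Equiv.sum_comp (Equiv.inv _)]
  refine Finset.sum_congr rfl fun σ _ => ?_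
  rw [map_smulₛₗ, adjoint_permOp, Equiv.inv_apply, coeff_centralIdem_inv, inv_inv]
  simp

theorem isClosed_isotypic : IsClosed (isotypic l T : Set (BergmanSpace n l)) := by
  have : (isotypic l T : Set (BergmanSpace n l)) = {f | isotypicProj l T f = f} :=
    Set.ext fun f => mem_isotypic T
  rw [this]
  exact isClosed_eq (isotypicProj l T).continuous continuous_id

variable (l) in
/-- The isotypic projection, with values in the isotypic submodule. -/
noncomputable def isotypicProj' : BergmanSpace n l →L[ℂ] isotypic l T :=
  (isotypicProj l T).codRestrict (isotypic l T) fun f => ⟨f, rfl⟩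

theorem coe_isotypicProj' (f : BergmanSpace n l) :
    (isotypicProj' l T f : BergmanSpace n l) = isotypicProj l T f := rfl

theorem isotypicProj'_coe (f : isotypic l T) : isotypicProj' l T f = f :=
  Subtype.ext ((mem_isotypic T).1 f.2)

theorem inner_isotypicProj' (f : isotypic l T) (g : BergmanSpace n l) :
    ⟪isotypicProj' l T g, f⟫_ℂ = ⟪g, (f : BergmanSpace n l)⟫_ℂ := by
  rw [Submodule.coe_inner, coe_isotypicProj', ← adjoint_isotypicProj,
    ContinuousLinearMap.adjoint_inner_left, (mem_isotypic T).1 f.2]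

end operators

/-! ### Holomorphy of the kernel functions and density of the polynomials -/

section kernel

/-- Quotients of the Taylor coefficients of `(1 - x) ^ (-l)` at distance `k` grow at most linearly in
`k`; this bounds the norm of the `k`-th power of a coordinate multiplication. -/
theorem binomCoeff_le {l : ℝ} (hl : 0 < l) (k m : ℕ) :
    binomCoeff l m ≤ (1 + k) * max 1 l⁻¹ * binomCoeff l (m + k) := by
  -- The sequence `m * binomCoeff l m` is nondecreasing, and equals `l` at `m = 1`.
  have hmono : Monotone fun m : ℕ => (m : ℝ) * binomCoeff l m := by
    refine monotone_nat_of_le_succ fun m => ?_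
    push_cast
    rw [binomCoeff_succ]
    exact mul_le_mul_of_nonneg_right (by linarith) (binomCoeff_pos hl m).le
  have hC1 : (1 : ℝ) ≤ max 1 l⁻¹ := le_max_left _ _
  have hpos := binomCoeff_pos hl (m + k)
  have hk : (0 : ℝ) ≤ k := k.cast_nonneg
  rcases Nat.eq_zero_or_pos m with rfl | hm
  · rcases Nat.eq_zero_or_pos k with rfl | hk1
    · simp [binomCoeff_zero]
    · have h1 := hmono hk1
      have h2 := binomCoeff_succ l 0
      simp only [Nat.cast_zero, zero_add, add_zero, one_mul, binomCoeff_zero, mul_one,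
        Nat.cast_one] at h1 h2
      rw [h2] at h1
      rw [zero_add] at hpos ⊢
      have h3 : l⁻¹ * l ≤ l⁻¹ * (k * binomCoeff l k) :=
        mul_le_mul_of_nonneg_left h1 (inv_pos.2 hl).le
      rw [inv_mul_cancel₀ hl.ne'] at h3
      rw [binomCoeff_zero]
      calc (1 : ℝ) ≤ l⁻¹ * (k * binomCoeff l k) := h3
        _ ≤ max 1 l⁻¹ * ((1 + k) * binomCoeff l k) := by
          gcongr
          · exact le_max_right _ _
          · linarith
        _ = _ := by ring
  · have h1 := hmono (Nat.le_add_right m k)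
    have hm' : (1 : ℝ) ≤ m := by exact_mod_cast hm
    push_cast at h1
    have h2 : binomCoeff l m ≤ (1 + k) * binomCoeff l (m + k) := by
      have h4 : ((m : ℝ) + k) ≤ m * (1 + k) := by nlinarith
      have h3 : (m : ℝ) * binomCoeff l m ≤ m * ((1 + k) * binomCoeff l (m + k)) :=
        h1.trans (by rw [← mul_assoc]; exact mul_le_mul_of_nonneg_right h4 hpos.le)
      exact le_of_mul_le_mul_left h3 (by linarith)
    refine h2.trans (mul_le_mul_of_nonneg_right ?_ hpos.le)
    exact le_mul_of_one_le_right (by linarith) hC1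

theorem isPosKernel_shift_pow {n : ℕ} {l : ℝ} (hl : 0 < l) (i : Fin n) (k : ℕ) :
    IsPosKernel fun z w : polydisc n =>
      ((((1 + k) * max 1 l⁻¹ : ℝ) : ℂ) - (z.1 i * conj (w.1 i)) ^ k) * bergmanKernel n l z w := by
  classical
  set C : ℝ := (1 + k) * max 1 l⁻¹ with hC
  have hC0 : 0 ≤ C := by positivity
  let c : ℕ → ℝ := fun m => C * binomCoeff l m - (if m < k then 0 else binomCoeff l (m - k))
  have hc : ∀ m, 0 ≤ c m := by
    intro m
    simp only [c]
    split_ifs with hm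
    · rw [sub_zero]
      exact mul_nonneg hC0 (binomCoeff_pos hl m).le
    · have := binomCoeff_le hl k (m - k)
      rw [Nat.sub_add_cancel (not_lt.1 hm)] at this
      exact sub_nonneg.2 this
  have hB : ∀ z w : polydisc n, HasSum (fun m => (c m : ℂ) * (z.1 i ^ m * conj (w.1 i ^ m)))
      (((C : ℂ) - (z.1 i * conj (w.1 i)) ^ k) * (1 - z.1 i * conj (w.1 i)) ^ (-(l : ℂ))) := by
    intro z w
    have h1 := hasSum_factor l i z w
    have h2 : HasSum (fun m : ℕ => ((if m < k then 0 else binomCoeff l (m - k) : ℝ) : ℂ) *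
        (z.1 i ^ m * conj (w.1 i ^ m)))
        ((z.1 i * conj (w.1 i)) ^ k * (1 - z.1 i * conj (w.1 i)) ^ (-(l : ℂ))) := by
      rw [← hasSum_nat_add_iff' k, Finset.sum_eq_zero (fun m hm => by
        simp [Finset.mem_range.1 hm]), sub_zero]
      refine Eq.mp (congrArg (fun f : ℕ → ℂ => HasSum f _) (funext fun m => ?_))
        (h1.mul_left ((z.1 i * conj (w.1 i)) ^ k))
      simp [pow_add, mul_pow]
      ring
    refine Eq.mp (congrArg₂ (fun (f : ℕ → ℂ) a => HasSum f a) (funext fun m => ?_) ?_)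
      ((h1.mul_left (C : ℂ)).sub h2)
    · simp only [c]; push_cast; ring
    · ring
  have key := (isPosKernel_prod (n := n) hl (Finset.univ.erase i)).mul_hasSum c hc
    (fun m z => z.1 i ^ m) hB
  intro s a
  refine (key s a).trans_eq ?_
  refine Finset.sum_congr rfl fun x _ => Finset.sum_congr rfl fun y _ => ?_
  simp only [bergmanKernel]
  rw [← Finset.mul_prod_erase _ _ (Finset.mem_univ i)]
  ring

variable {n : ℕ} {l : ℝ} [hl : Fact (0 < l)]

theorem adjoint_mulOp_kerFun (q : MvPolynomial (Fin n) ℂ) (x : polydisc n) (a : ℂ) :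
    ContinuousLinearMap.adjoint (mulOp q) (RKHS.kerFun (BergmanSpace n l) x a) =
      RKHS.kerFun (BergmanSpace n l) x (conj (MvPolynomial.eval x.1 q) * a) := by
  refine ext_inner_right ℂ fun f => ?_
  rw [ContinuousLinearMap.adjoint_inner_left, RKHS.kerFun_inner, RKHS.kerFun_inner, mulOp_apply]
  simp
  ring

theorem norm_le_of_kerFun (S : BergmanSpace n l →L[ℂ] BergmanSpace n l) {C : ℝ} (hC : 0 ≤ C)
    (h : ∀ (s : Finset (polydisc n)) (a : polydisc n → ℂ),
      ‖S (∑ x ∈ s, RKHS.kerFun (BergmanSpace n l) x (a x))‖ ≤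
        C * ‖∑ x ∈ s, RKHS.kerFun (BergmanSpace n l) x (a x)‖) : ‖S‖ ≤ C := by
  refine S.opNorm_le_bound hC fun f => ?_
  let e : (polydisc n →₀ ℂ) →ₗ[ℂ] BergmanSpace n l :=
    Finsupp.lsum ℂ fun x => (RKHS.kerFun (BergmanSpace n l) x).toLinearMap
  have he : DenseRange e := by
    have h1 := RKHS.kerFun_dense (BergmanSpace n l)
    rw [← Submodule.dense_iff_topologicalClosure_eq_top] at h1
    refine h1.mono ?_
    change _ ⊆ ((LinearMap.range e : Submodule ℂ (BergmanSpace n l)) : Set (BergmanSpace n l))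
    rw [SetLike.coe_subset_coe, Submodule.span_le]
    rintro _ ⟨x, v, rfl⟩
    exact ⟨Finsupp.single x v, by simp [e]⟩
  refine he.induction_on f
    (isClosed_le S.continuous.norm (continuous_const.mul continuous_norm)) fun v => ?_
  simpa [e, Finsupp.sum] using h v.support v

/-- Powers of a coordinate function act with polynomially growing norms. For `l < 1` the
coordinate functions are not contractions. -/
theorem norm_mulOp_X_pow_le (i : Fin n) (k : ℕ) :
    ‖(mulOp (MvPolynomial.X i ^ k) : BergmanSpace n l →L[ℂ] BergmanSpace n l)‖ ≤
      (1 + k) * max 1 l⁻¹ := by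
  set C : ℝ := (1 + k) * max 1 l⁻¹ with hC
  have hC1 : 1 ≤ C := one_le_mul_of_one_le_of_one_le (by simp) (le_max_left _ _)
  have hC0 : 0 ≤ C := zero_le_one.trans hC1
  rw [← ContinuousLinearMap.adjoint.norm_map]
  refine norm_le_of_kerFun _ hC0 fun s a => ?_
  simp only [map_sum, adjoint_mulOp_kerFun]
  refine le_of_sq_le_sq ?_ (by positivity)
  have h1 := norm_sq_sum_kerFun (l := l) s id
    fun x => conj (MvPolynomial.eval x.1 (MvPolynomial.X i ^ k)) * a x
  have h2 := norm_sq_sum_kerFun (l := l) s id a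
  simp only [id] at h1 h2
  have h3 : ‖∑ x ∈ s, RKHS.kerFun (BergmanSpace n l) x
      (conj (MvPolynomial.eval x.1 (MvPolynomial.X i ^ k)) * a x)‖ ^ 2 ≤
        C * ‖∑ x ∈ s, RKHS.kerFun (BergmanSpace n l) x (a x)‖ ^ 2 := by
    rw [← sub_nonneg, ← Complex.zero_le_real, Complex.ofReal_sub, Complex.ofReal_mul, h1, h2]
    refine (isPosKernel_shift_pow (n := n) hl.out i k s a).trans_eq ?_
    rw [Finset.mul_sum, ← Finset.sum_sub_distrib]
    refine Finset.sum_congr rfl fun x _ => ?_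
    rw [Finset.mul_sum, ← Finset.sum_sub_distrib]
    refine Finset.sum_congr rfl fun y _ => ?_
    simp [hC]
    ring
  refine h3.trans ?_
  rw [mul_pow]
  exact mul_le_mul_of_nonneg_right (by nlinarith) (by positivity)

theorem summable_binomCoeff_mul {r : ℝ} (hr0 : 0 ≤ r) (hr : r < 1) :
    Summable fun k : ℕ => binomCoeff l k * r ^ k * ((1 + k) * max 1 l⁻¹) := by
  obtain ⟨ρ, hrρ, hρ⟩ := exists_between hr
  have hρ0 : 0 < ρ := hr0.trans_lt hrρ
  have h1 : Summable fun k : ℕ => binomCoeff l k * ρ ^ k := by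
    have h := (hasSum_binomCoeff l (x := (ρ : ℂ))
      (by simpa [abs_of_pos hρ0] using hρ)).summable
    exact Complex.summable_ofReal.1 (by simpa using h)
  have h2 : Filter.Tendsto (fun k : ℕ => (k : ℝ) * (r / ρ) ^ k) Filter.atTop (nhds 0) :=
    tendsto_self_mul_const_pow_of_lt_one (by positivity) ((div_lt_one hρ0).2 hrρ)
  obtain ⟨B, hB⟩ := h2.bddAbove_range
  refine Summable.of_nonneg_of_le (fun k => ?_) (fun k => ?_) (h1.mul_left ((1 + B) * max 1 l⁻¹))
  · have := binomCoeff_pos hl.out k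
    positivity
  · have hb := binomCoeff_pos hl.out k
    have h3 : (1 + (k : ℝ)) * (r / ρ) ^ k ≤ 1 + B := by
      rw [add_mul, one_mul]
      exact add_le_add (pow_le_one₀ (by positivity) ((div_lt_one hρ0).2 hrρ).le)
        (hB ⟨k, rfl⟩)
    calc binomCoeff l k * r ^ k * ((1 + k) * max 1 l⁻¹)
        = max 1 l⁻¹ * (binomCoeff l k * ρ ^ k) * ((1 + (k : ℝ)) * (r / ρ) ^ k) := by
          rw [div_pow]; field_simp
      _ ≤ max 1 l⁻¹ * (binomCoeff l k * ρ ^ k) * (1 + B) :=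
          mul_le_mul_of_nonneg_left h3 (by positivity)
      _ = _ := by ring

variable (l) in
/-- Multiplication by `(1 - t * z_i) ^ (-l)`, as the sum of its binomial series in the multiplication
by `z_i`. -/
noncomputable def factorOp (i : Fin n) (t : ℂ) : BergmanSpace n l →L[ℂ] BergmanSpace n l :=
  ∑' k : ℕ, ((binomCoeff l k : ℂ) * t ^ k) • mulOp (MvPolynomial.X i ^ k)

theorem norm_factorOp_term_le (i : Fin n) {r : ℝ} {t : ℂ} (ht : ‖t‖ ≤ r) (k : ℕ) :
    ‖((binomCoeff l k : ℂ) * t ^ k) •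
      (mulOp (MvPolynomial.X i ^ k) : BergmanSpace n l →L[ℂ] BergmanSpace n l)‖ ≤
        binomCoeff l k * r ^ k * ((1 + k) * max 1 l⁻¹) := by
  have hb := binomCoeff_pos hl.out k
  rw [norm_smul, norm_mul, norm_pow, Complex.norm_real, Real.norm_of_nonneg hb.le]
  have hr : 0 ≤ r := (norm_nonneg t).trans ht
  exact mul_le_mul (mul_le_mul_of_nonneg_left (pow_le_pow_left₀ (norm_nonneg t) ht k) hb.le)
    (norm_mulOp_X_pow_le i k) (norm_nonneg _) (mul_nonneg hb.le (pow_nonneg hr k))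

theorem hasSum_factorOp (i : Fin n) {t : ℂ} (ht : ‖t‖ < 1) :
    HasSum (fun k : ℕ => ((binomCoeff l k : ℂ) * t ^ k) •
      (mulOp (MvPolynomial.X i ^ k) : BergmanSpace n l →L[ℂ] BergmanSpace n l))
      (factorOp l i t) :=
  (Summable.of_norm_bounded (summable_binomCoeff_mul (l := l) (norm_nonneg t) ht)
    (norm_factorOp_term_le (l := l) i le_rfl)).hasSum

theorem differentiableOn_factorOp (i : Fin n) :
    DifferentiableOn ℂ (factorOp (n := n) l i) (Metric.ball 0 1) := by
  intro t ht
  rw [mem_ball_zero_iff] at ht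
  obtain ⟨r, htr, hr⟩ := exists_between ht
  have h := Complex.differentiableOn_tsum_of_summable_norm (U := Metric.ball (0 : ℂ) r)
    (F := fun (k : ℕ) t => ((binomCoeff l k : ℂ) * t ^ k) •
      (mulOp (MvPolynomial.X i ^ k) : BergmanSpace n l →L[ℂ] BergmanSpace n l))
    (summable_binomCoeff_mul ((norm_nonneg t).trans htr.le) hr)
    (fun k => by fun_prop) Metric.isOpen_ball
    (fun k t ht => norm_factorOp_term_le i (mem_ball_zero_iff.1 ht).le k)
  exact (h.differentiableAt (Metric.isOpen_ball.mem_nhds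
    (mem_ball_zero_iff.2 htr))).differentiableWithinAt

theorem factorOp_apply (i : Fin n) {t : ℂ} (ht : ‖t‖ < 1) (f : BergmanSpace n l)
    (z : polydisc n) : factorOp l i t f z = (1 - z.1 i * t) ^ (-(l : ℂ)) * f z := by
  have h1 := ((hasSum_factorOp (l := l) i ht).mapL
    (ContinuousLinearMap.apply ℂ (BergmanSpace n l) f)).mapL
      (innerSL ℂ (kernelAt n l z))
  have hz : ‖z.1 i * t‖ < 1 := by
    rw [norm_mul]
    exact mul_lt_one_of_nonneg_of_lt_one_left (norm_nonneg _) (z.2 i) ht.le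
  have h2 := (hasSum_binomCoeff l hz).mul_right (f z)
  simp only [innerSL_apply_apply, inner_kernelAt, ContinuousLinearMap.apply_apply] at h1
  refine h1.unique (Eq.mp (congrArg (fun f : ℕ → ℂ => HasSum f _) (funext fun k => ?_)) h2)
  simp [mulOp_apply, mul_pow]
  ring

variable (n l) in
/-- The constant function `1`, which is the kernel function of the origin. -/
noncomputable def constOne : BergmanSpace n l := kernelAt n l ⟨0, fun _ => by simp⟩

theorem constOne_apply (z : polydisc n) : constOne n l z = 1 := by
  simp [constOne, kernelAt_apply, bergmanKernel]

theorem mulOp_constOne_apply (q : MvPolynomial (Fin n) ℂ) (z : polydisc n) :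
    mulOp q (constOne n l) z = MvPolynomial.eval z.1 q := by
  rw [mulOp_apply, constOne_apply, mul_one]

theorem mulOp_mulOp (q r : MvPolynomial (Fin n) ℂ) (f : BergmanSpace n l) :
    mulOp q (mulOp r f) = mulOp (q * r) f :=
  RKHS.ext fun z => by simp [mulOp_apply, mul_assoc]

theorem isOpen_polydisc : IsOpen (polydisc n) := by
  simp only [polydisc, Set.ofPred_forall]
  exact isOpen_iInter_of_finite fun i => isOpen_lt (by fun_prop) continuous_const

/-- The partial products of the kernel, in the variable `β = conj w`, are holomorphic with values in
the Bergman space, and lie in the closed span of the polynomials (stated through orthogonality);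
the factors are introduced one at a time by the operators `factorOp`. -/
theorem exists_partialKernel (s : Finset (Fin n)) :
    ∃ F : (Fin n → ℂ) → BergmanSpace n l, DifferentiableOn ℂ F (polydisc n) ∧
      (∀ β ∈ polydisc n, ∀ z, F β z = ∏ i ∈ s, (1 - z.1 i * β i) ^ (-(l : ℂ))) ∧
      ∀ f, (∀ q, ⟪mulOp q (constOne n l), f⟫_ℂ = 0) →
        ∀ β ∈ polydisc n, ∀ q, ⟪mulOp q (F β), f⟫_ℂ = 0 := by
  classical
  induction s using Finset.induction_on with
  | empty =>
    exact ⟨fun _ => constOne n l, differentiableOn_const _, fun β _ z => by simp [constOne_apply],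
      fun f hf β _ q => hf q⟩
  | insert i s hi ih =>
    obtain ⟨F, hF1, hF2, hF3⟩ := ih
    refine ⟨fun β => factorOp l i (β i) (F β), ?_, fun β hβ z => ?_, fun f hf β hβ q => ?_⟩
    · refine DifferentiableOn.clm_apply ?_ hF1
      exact (differentiableOn_factorOp i).comp (differentiable_apply i).differentiableOn
        fun β hβ => mem_ball_zero_iff.2 (hβ i)
    · rw [factorOp_apply i (hβ i), hF2 β hβ, Finset.prod_insert hi]
    · have h1 := ((hasSum_factorOp (l := l) i (hβ i)).mapL
        (ContinuousLinearMap.apply ℂ (BergmanSpace n l) (F β))).mapL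
          ((innerSL ℂ f).comp (mulOp q))
      have h2 : ⟪f, mulOp q (factorOp l i (β i) (F β))⟫_ℂ = 0 := by
        refine h1.unique ?_
        refine Eq.mp (congrArg (fun f : ℕ → ℂ => HasSum f _) (funext fun k => ?_)) hasSum_zero
        have := hF3 f hf β hβ (q * MvPolynomial.X i ^ k)
        rw [inner_eq_zero_symm] at this
        simp [mulOp_mulOp, this]
      exact inner_eq_zero_symm.1 h2

variable (n l) in
/-- The kernel function `K(·, w)` depends holomorphically on `β = conj w`. -/
theorem exists_holomorphic_kernel :
    ∃ F : (Fin n → ℂ) → BergmanSpace n l, DifferentiableOn ℂ F (polydisc n) ∧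
      ∀ b : polydisc n, F (star b.1) = kernelAt n l b := by
  obtain ⟨F, hF1, hF2, -⟩ := exists_partialKernel (l := l) (Finset.univ : Finset (Fin n))
  refine ⟨F, hF1, fun b => RKHS.ext fun z => ?_⟩
  rw [hF2 _ (fun i => by simpa using b.2 i), kernelAt_apply, bergmanKernel]
  rfl

/-- The polynomials are dense: a function orthogonal to all of them is zero. -/
theorem eq_zero_of_forall_inner_polynomial (f : BergmanSpace n l)
    (hf : ∀ q, ⟪mulOp q (constOne n l), f⟫_ℂ = 0) : f = 0 := by
  obtain ⟨F, -, hF2, hF3⟩ := exists_partialKernel (l := l) (Finset.univ : Finset (Fin n))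
  refine RKHS.ext fun b => ?_
  have hb : star b.1 ∈ polydisc n := fun i => by simpa using b.2 i
  have h1 : mulOp 1 (F (star b.1)) = kernelAt n l b := by
    refine RKHS.ext fun z => ?_
    rw [mulOp_apply, hF2 _ hb, kernelAt_apply, bergmanKernel, map_one, one_mul]
    rfl
  rw [← inner_kernelAt, ← h1, hF3 f hf _ hb, RKHS.coe_zero, Pi.zero_apply]

end kernel

/-! ### Interpolation on the orbit of a point -/

section interpolation

variable {n : ℕ}

/-- For pairwise distinct `b i`, the polynomial `∏ i, ℓ_{τ i}(z_i)`, with `ℓ_j` the Lagrange basis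
polynomials for the nodes `b`. At `b ∘ σ` it takes the value `1` if `σ = τ`, else `0`. -/
noncomputable def orbitBasis (b : Fin n → ℂ) (τ : Fin n → Fin n) : MvPolynomial (Fin n) ℂ :=
  ∏ i, Polynomial.aeval (MvPolynomial.X i : MvPolynomial (Fin n) ℂ)
    (Lagrange.basis Finset.univ b (τ i))

theorem aeval_orbitBasis {Q : Type*} [CommRing Q] [Algebra ℂ Q] (y : Fin n → Q)
    (b : Fin n → ℂ) (τ : Fin n → Fin n) :
    MvPolynomial.aeval y (orbitBasis b τ) =
      ∏ i, Polynomial.aeval (y i) (Lagrange.basis Finset.univ b (τ i)) := by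
  rw [orbitBasis, map_prod]
  refine Finset.prod_congr rfl fun i _ => ?_
  rw [← Polynomial.aeval_algHom_apply, MvPolynomial.aeval_X]

theorem eval_orbitBasis {b : Fin n → ℂ} (hb : Function.Injective b) (σ τ : Fin n → Fin n) :
    MvPolynomial.eval (b ∘ σ) (orbitBasis b τ) = if σ = τ then 1 else 0 := by
  have h := aeval_orbitBasis (Q := ℂ) (b ∘ σ) b τ
  rw [MvPolynomial.aeval_eq_eval] at h
  refine Eq.trans h ?_
  split_ifs with hστ
  · subst hστ
    refine Finset.prod_eq_one fun i _ => ?_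
    simpa using Lagrange.eval_basis_self (hb.injOn (s := ↑(Finset.univ : Finset (Fin n))))
      (Finset.mem_univ (σ i))
  · obtain ⟨i, hi⟩ := Function.ne_iff.1 hστ
    refine Finset.prod_eq_zero (Finset.mem_univ i) ?_
    simpa using Lagrange.eval_basis_of_ne (v := b) hi.symm (Finset.mem_univ (σ i))

/-- Interpolation formula in a commutative algebra: if elements `y i` have the same elementary
symmetric functions as distinct scalars `b i`, then every polynomial in the `y i` is determined by
its values at the points `b ∘ σ`. The Lagrange idempotents `ℓ_j(y_i)` split `1` into products
`∏ i, ℓ_{τ i}(y_i)`, on which `y_i` acts as `b (τ i)`; unless `τ` is a permutation, this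
contradicts the equality of elementary symmetric functions, and the product is zero. -/
theorem aeval_eq_sum_orbitBasis {Q : Type*} [CommRing Q] [Algebra ℂ Q] {y : Fin n → Q}
    {b : Fin n → ℂ} (hb : Function.Injective b)
    (hyb : ∏ i, (Polynomial.X - Polynomial.C (y i)) =
      ∏ i, (Polynomial.X - Polynomial.C (algebraMap ℂ Q (b i))))
    (q : MvPolynomial (Fin n) ℂ) :
    MvPolynomial.aeval y q = ∑ σ : Equiv.Perm (Fin n),
      MvPolynomial.eval (b ∘ σ) q • MvPolynomial.aeval y (orbitBasis b σ) := by
  classical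
  have hroot (i : Fin n) : ∏ j, (y i - algebraMap ℂ Q (b j)) = 0 := by
    have h := congrArg (Polynomial.eval (y i)) hyb
    simp only [Polynomial.eval_prod, Polynomial.eval_sub, Polynomial.eval_X,
      Polynomial.eval_C] at h
    rw [← h]
    exact Finset.prod_eq_zero (Finset.mem_univ i) (sub_self _)
  have heig (i j : Fin n) : y i * Polynomial.aeval (y i) (Lagrange.basis Finset.univ b j) =
      b j • Polynomial.aeval (y i) (Lagrange.basis Finset.univ b j) := by
    have h1 : (Polynomial.X - Polynomial.C (b j)) * Lagrange.basis Finset.univ b j =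
        Polynomial.C (∏ k ∈ Finset.univ.erase j, (b j - b k)⁻¹) *
          ∏ k, (Polynomial.X - Polynomial.C (b k)) := by
      rw [← Finset.mul_prod_erase _ _ (Finset.mem_univ j), Lagrange.basis]
      simp only [Lagrange.basisDivisor, Finset.prod_mul_distrib, map_prod]
      ring
    have h2 := congrArg (Polynomial.aeval (y i)) h1
    simp only [map_mul, map_sub, Polynomial.aeval_X, Polynomial.aeval_C, map_prod,
      hroot, mul_zero] at h2
    rw [sub_mul, sub_eq_zero] at h2
    rw [h2, Algebra.smul_def]
  have hsum : ∑ τ : Fin n → Fin n, MvPolynomial.aeval y (orbitBasis b τ) = 1 := by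
    simp only [aeval_orbitBasis]
    rw [← Fintype.prod_sum fun i j => Polynomial.aeval (y i) (Lagrange.basis Finset.univ b j)]
    refine Finset.prod_eq_one fun i _ => ?_
    rw [← map_sum, Lagrange.sum_basis hb.injOn ⟨i, Finset.mem_univ i⟩, map_one]
  have heigτ (τ : Fin n → Fin n) (i : Fin n) : y i * MvPolynomial.aeval y (orbitBasis b τ) =
      b (τ i) • MvPolynomial.aeval y (orbitBasis b τ) := by
    rw [aeval_orbitBasis, ← Finset.mul_prod_erase _ _ (Finset.mem_univ i), ← mul_assoc, heig,
      smul_mul_assoc]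
  have hval (τ : Fin n → Fin n) (q : MvPolynomial (Fin n) ℂ) :
      MvPolynomial.aeval y q * MvPolynomial.aeval y (orbitBasis b τ) =
        MvPolynomial.eval (b ∘ τ) q • MvPolynomial.aeval y (orbitBasis b τ) := by
    induction q using MvPolynomial.induction_on with
    | C a => simp [Algebra.smul_def]
    | add p q hp hq => rw [map_add, add_mul, hp, hq, map_add, add_smul]
    | mul_X p i hp =>
      rw [map_mul, MvPolynomial.aeval_X, mul_assoc, heigτ, mul_smul_comm, hp, smul_smul, map_mul,
        MvPolynomial.eval_X, mul_comm, Function.comp_apply]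
  have hzero (τ : Fin n → Fin n) (hτ : ¬ Function.Bijective τ) :
      MvPolynomial.aeval y (orbitBasis b τ) = 0 := by
    set E := MvPolynomial.aeval y (orbitBasis b τ) with hE
    have hτs : ¬ Function.Surjective τ := fun h => hτ (Finite.surjective_iff_bijective.1 h)
    obtain ⟨j, hj⟩ : ∃ j, ∀ i, τ i ≠ j := by
      simpa [Function.Surjective] using hτs
    -- For an omitted node `b j`, the polynomial `∏ i, (b j - z_i)` vanishes at `y`, because of the
    -- two factorizations, but it acts on `E` as a nonzero scalar.
    have h1 := congrArg (Polynomial.eval (algebraMap ℂ Q (b j))) hyb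
    simp only [Polynomial.eval_prod, Polynomial.eval_sub, Polynomial.eval_X,
      Polynomial.eval_C] at h1
    replace h1 := h1.trans (Finset.prod_eq_zero (Finset.mem_univ j) (sub_self _))
    have h2 := hval τ (∏ i, (MvPolynomial.C (b j) - MvPolynomial.X i))
    simp only [map_prod, map_sub, MvPolynomial.aeval_C, MvPolynomial.aeval_X, h1, zero_mul,
      MvPolynomial.eval_C, MvPolynomial.eval_X] at h2
    refine (smul_eq_zero_iff_right ?_).1 h2.symm
    refine Finset.prod_ne_zero_iff.2 fun i _ => sub_ne_zero.2 fun h => hj i (hb h).symm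
  calc MvPolynomial.aeval y q
      = ∑ τ : Fin n → Fin n, MvPolynomial.eval (b ∘ τ) q •
          MvPolynomial.aeval y (orbitBasis b τ) := by
        rw [← mul_one (MvPolynomial.aeval y q), ← hsum, Finset.mul_sum]
        exact Finset.sum_congr rfl fun τ _ => hval τ q
    _ = _ := by
        symm
        refine Finset.sum_of_injOn (fun σ : Equiv.Perm (Fin n) => (σ : Fin n → Fin n))
          (DFunLike.coe_injective.injOn) (fun _ _ => Finset.mem_coe.2 (Finset.mem_univ _))
          (fun τ _ h => ?_) (fun _ _ => rfl)
        rw [hzero τ fun hb => h ⟨Equiv.ofBijective τ hb, by simp, rfl⟩, smul_zero]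

theorem prod_X_sub_C_eq_sum_esymm {Q : Type*} [CommRing Q] [Algebra ℂ Q] (y : Fin n → Q) :
    ∏ i, (Polynomial.X - Polynomial.C (y i)) =
      ∑ j ∈ Finset.range (n + 1), (-1) ^ j *
        (Polynomial.C (MvPolynomial.aeval y (MvPolynomial.esymm (Fin n) ℂ j)) *
          Polynomial.X ^ (n - j)) := by
  have := Multiset.prod_X_sub_X_eq_sum_esymm (Finset.univ.val.map y)
  simp only [← MvPolynomial.aeval_esymm_eq_multiset_esymm (Fin n) ℂ, Multiset.map_map,
    Multiset.card_map, Finset.card_val, Finset.card_univ, Fintype.card_fin] at this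
  exact this

theorem prod_X_sub_C_eq_of_esymm_eq {Q : Type*} [CommRing Q] [Algebra ℂ Q] (y y' : Fin n → Q)
    (h : ∀ k : Fin n, MvPolynomial.aeval y (MvPolynomial.esymm (Fin n) ℂ (k + 1)) =
      MvPolynomial.aeval y' (MvPolynomial.esymm (Fin n) ℂ (k + 1))) :
    ∏ i, (Polynomial.X - Polynomial.C (y i)) = ∏ i, (Polynomial.X - Polynomial.C (y' i)) := by
  rw [prod_X_sub_C_eq_sum_esymm, prod_X_sub_C_eq_sum_esymm]
  refine Finset.sum_congr rfl fun j hj => ?_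
  rcases Nat.eq_zero_or_pos j with rfl | hj0
  · simp
  · have := h ⟨j - 1, by rw [Finset.mem_range] at hj; omega⟩
    simp only [Nat.sub_add_cancel hj0] at this
    rw [this]

theorem prod_sub_eq_sum_symmetrization (x : ℂ) (z : Fin n → ℂ) :
    ∏ i, (x - z i) =
      x ^ n + ∑ k : Fin n, (-1) ^ (k + 1 : ℕ) * symmetrization n z k * x ^ (n - (k + 1)) := by
  have h := congrArg (Polynomial.eval x) (prod_X_sub_C_eq_sum_esymm z)
  rw [Finset.sum_range_succ', ← Fin.sum_univ_eq_sum_range fun k => (-1 : Polynomial ℂ) ^ (k + 1) *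
    (Polynomial.C (MvPolynomial.aeval z (MvPolynomial.esymm (Fin n) ℂ (k + 1))) *
      Polynomial.X ^ (n - (k + 1)))] at h
  simpa [Polynomial.eval_prod, Polynomial.eval_finsetSum, MvPolynomial.aeval_eq_eval,
    symmetrization, add_comm, mul_assoc] using h

/-- Modulo the ideal generated by the functions `s_k - s_k(b)`, every polynomial agrees with its
interpolation on the orbit of `b`. -/
theorem sub_sum_orbitBasis_mem {b : Fin n → ℂ} (hb : Function.Injective b)
    (q : MvPolynomial (Fin n) ℂ) :
    q - ∑ σ : Equiv.Perm (Fin n), MvPolynomial.eval (b ∘ σ) q • orbitBasis b σ ∈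
      Ideal.span (Set.range fun k : Fin n => MvPolynomial.esymm (Fin n) ℂ (k + 1) -
        MvPolynomial.C (symmetrization n b k)) := by
  set I := Ideal.span (Set.range fun k : Fin n => MvPolynomial.esymm (Fin n) ℂ (k + 1) -
    MvPolynomial.C (symmetrization n b k)) with hI
  let π := Ideal.Quotient.mkₐ ℂ I
  have hπ : π = MvPolynomial.aeval fun i => π (MvPolynomial.X i) :=
    MvPolynomial.aeval_unique π
  rw [← Ideal.Quotient.eq_zero_iff_mem]
  change π _ = 0
  rw [map_sub, map_sum, sub_eq_zero]
  simp only [map_smul]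
  rw [hπ]
  refine aeval_eq_sum_orbitBasis hb (prod_X_sub_C_eq_of_esymm_eq _ _ fun k => ?_) q
  rw [← hπ]
  have h1 : π (MvPolynomial.esymm (Fin n) ℂ (k + 1) -
      MvPolynomial.C (symmetrization n b k)) = 0 :=
    Ideal.Quotient.eq_zero_iff_mem.2 (Ideal.subset_span ⟨k, rfl⟩)
  rw [map_sub, sub_eq_zero] at h1
  rw [h1]
  refine (π.commutes _).trans ?_
  rw [symmetrization, ← MvPolynomial.aeval_eq_eval, ← MvPolynomial.aeval_algebraMap_apply]
  rfl

end interpolation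

/-! ### Local inverses of the symmetrization map -/

section localInverse

variable {n : ℕ}

theorem contDiff_symmetrization : ContDiff ℂ 1 (symmetrization n) := by
  refine contDiff_pi.2 fun k => ?_
  simp only [symmetrization, MvPolynomial.esymm, map_sum, map_prod, MvPolynomial.eval_X]
  exact ContDiff.sum fun t _ => contDiff_prod fun i _ => contDiff_apply ℂ ℂ i

theorem symmetrization_comp_perm (b : Fin n → ℂ) (σ : Equiv.Perm (Fin n)) :
    symmetrization n (b ∘ σ) = symmetrization n b := by
  funext k
  rw [symmetrization, ← MvPolynomial.eval_rename, MvPolynomial.esymm_isSymmetric]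
  rfl

theorem symmetrization_star (b : Fin n → ℂ) :
    symmetrization n (star b) = star (symmetrization n b) := by
  funext k
  simp [symmetrization, MvPolynomial.esymm]

/-- At a point `a` with distinct coordinates, `s` is an immersion: differentiating
`∏ j, (x - z_j)`, a polynomial in `x` whose coefficients are given by `s(z)`, and putting `x = a_i`
leaves only the term containing the `i`-th component of the direction. -/
theorem injective_fderiv_symmetrization {a : Fin n → ℂ} (ha : Function.Injective a) :
    Function.Injective (fderiv ℂ (symmetrization n) a) := by
  rw [injective_iff_map_eq_zero]
  intro h hh
  funext i
  have hs : HasDerivAt (fun t : ℂ => symmetrization n (a + t • h)) 0 0 := by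
    have h1 : HasFDerivAt (symmetrization n) (fderiv ℂ (symmetrization n) a)
        (a + (0 : ℂ) • h) := by
      rw [zero_smul, add_zero]
      exact (contDiff_symmetrization.differentiable (by simp) a).hasFDerivAt
    have h2 : HasDerivAt (fun t : ℂ => a + t • h) h 0 := by
      simpa using ((hasDerivAt_id (0 : ℂ)).smul_const h).const_add a
    have h3 := h1.comp_hasDerivAt 0 h2
    rw [hh] at h3
    exact h3
  have h3 : HasDerivAt (fun t : ℂ => ∏ j, (a i - (a + t • h) j)) 0 0 := by
    simp only [prod_sub_eq_sum_symmetrization]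
    have := HasDerivAt.fun_sum (u := Finset.univ) fun (k : Fin n) _ =>
      (((hasDerivAt_pi.1 hs k).const_mul ((-1) ^ (k + 1 : ℕ))).mul_const (a i ^ (n - (k + 1))))
    simpa using this.const_add (a i ^ n)
  let g : ℂ → ℂ := fun t => ∏ j ∈ Finset.univ.erase i, (a i - (a + t • h) j)
  have hg : DifferentiableAt ℂ g 0 := by
    refine DifferentiableAt.fun_finsetProd fun j _ => ?_
    simp only [Pi.add_apply, Pi.smul_apply, smul_eq_mul]
    fun_prop
  have h4 : HasDerivAt (fun t : ℂ => ∏ j, (a i - (a + t • h) j)) (-h i * g 0) 0 := by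
    have e : (fun t : ℂ => ∏ j, (a i - (a + t • h) j)) = fun t => t * -h i * g t := by
      funext t
      rw [← Finset.mul_prod_erase _ _ (Finset.mem_univ i)]
      simp [g]
    rw [e]
    simpa using ((hasDerivAt_id (0 : ℂ)).mul_const (-h i)).fun_mul hg.hasDerivAt
  have h5 := h4.unique h3
  have h6 : g 0 ≠ 0 := Finset.prod_ne_zero_iff.2 fun j hj => by
    simpa [sub_eq_zero] using fun e => (Finset.ne_of_mem_erase hj) (ha e).symm
  simpa [h6] using h5

/-- A holomorphic local section of the symmetrization map through a point with distinct
coordinates. -/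
theorem exists_local_section {a : Fin n → ℂ} (ha : Function.Injective a) {V : Set (Fin n → ℂ)}
    (hV : V ∈ nhds a) :
    ∃ (U : Set (Fin n → ℂ)) (ψ : (Fin n → ℂ) → (Fin n → ℂ)), IsOpen U ∧ symmetrization n a ∈ U ∧
      DifferentiableOn ℂ ψ U ∧ ∀ w ∈ U, symmetrization n (ψ w) = w ∧ ψ w ∈ V := by
  let f' : (Fin n → ℂ) ≃L[ℂ] (Fin n → ℂ) :=
    (LinearEquiv.ofInjectiveEndo (fderiv ℂ (symmetrization n) a).toLinearMap
      (injective_fderiv_symmetrization ha)).toContinuousLinearEquiv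
  have hf : ContDiffAt ℂ 1 (symmetrization n) a := contDiff_symmetrization.contDiffAt
  have hf' : HasFDerivAt (symmetrization n) (f' : (Fin n → ℂ) →L[ℂ] (Fin n → ℂ)) a := by
    have := (contDiff_symmetrization.differentiable (by simp) a).hasFDerivAt
    exact this
  have hst := hf.hasStrictFDerivAt' hf' (by simp)
  let ψ := hf.localInverse hf' (by simp)
  have h1 : ContDiffAt ℂ 1 ψ (symmetrization n a) := hf.to_localInverse hf' (by simp)
  have h2 : ∀ᶠ w in nhds (symmetrization n a), DifferentiableAt ℂ ψ w :=
    (h1.eventually (by simp)).mono fun w hw => hw.differentiableAt (by simp)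
  have h3 : ∀ᶠ w in nhds (symmetrization n a), symmetrization n (ψ w) = w :=
    hst.eventually_right_inverse
  have h4 : ∀ᶠ w in nhds (symmetrization n a), ψ w ∈ V := by
    refine h1.continuousAt.eventually_mem ?_
    have : ψ (symmetrization n a) = a := hf.localInverse_apply_image hf' (by simp)
    rwa [this]
  obtain ⟨U, hU, hUo, haU⟩ := mem_nhds_iff.1 ((h2.and (h3.and h4)))
  exact ⟨U, ψ, hUo, haU, fun w hw => (hU hw).1.differentiableWithinAt, fun w hw => (hU hw).2⟩

end localInverse

/-! ### The module tensor product at a regular value of the symmetrization map -/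

section tensor

variable {n : ℕ} {l : ℝ} [hl : Fact (0 < l)]

variable (n l) in
/-- The polynomials as elements of the weighted Bergman space. -/
noncomputable def polyFun : MvPolynomial (Fin n) ℂ →ₗ[ℂ] BergmanSpace n l where
  toFun q := mulOp q (constOne n l)
  map_add' q r := RKHS.ext fun z => by simp [mulOp_constOne_apply]
  map_smul' c q := RKHS.ext fun z => by simp [mulOp_constOne_apply]

theorem polyFun_apply (q : MvPolynomial (Fin n) ℂ) (z : polydisc n) :
    polyFun n l q z = MvPolynomial.eval z.1 q := mulOp_constOne_apply q z

theorem inner_polyFun_kernelAt (q : MvPolynomial (Fin n) ℂ) (b : polydisc n) :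
    ⟪polyFun n l q, kernelAt n l b⟫_ℂ = conj (MvPolynomial.eval b.1 q) := by
  rw [← inner_conj_symm, inner_kernelAt, polyFun_apply]

theorem coe_permAct (σ : Equiv.Perm (Fin n)) (b : polydisc n) :
    (permAct σ b).1 = b.1 ∘ ⇑σ⁻¹ := rfl

theorem symmetrization_permAct (σ : Equiv.Perm (Fin n)) (b : polydisc n) :
    symmetrization n (permAct σ b).1 = symmetrization n b.1 := by
  rw [coe_permAct, symmetrization_comp_perm]

variable (l) in
/-- The combination `∑ σ, x(σ) K(·, σ · b)` of the kernel functions on the orbit of `b`. -/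
noncomputable def orbitMap (b : polydisc n) :
    MonoidAlgebra ℂ (Equiv.Perm (Fin n)) →ₗ[ℂ] BergmanSpace n l :=
  (ContinuousLinearMap.apply ℂ (BergmanSpace n l) (kernelAt n l b)).toLinearMap ∘ₗ
    (permRep n l).toLinearMap

theorem orbitMap_apply (b : polydisc n) (x : MonoidAlgebra ℂ (Equiv.Perm (Fin n))) :
    orbitMap l b x = permRep n l x (kernelAt n l b) := rfl

theorem orbitMap_eq_sum (b : polydisc n) (x : MonoidAlgebra ℂ (Equiv.Perm (Fin n))) :
    orbitMap l b x = ∑ σ, x.coeff σ • kernelAt n l (permAct σ b) := by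
  rw [orbitMap_apply, permRep_apply, sum_apply]
  simp [permOp_kernelAt]

/-- The kernel functions on the orbit of a point with distinct coordinates are linearly
independent, since polynomials separate the points of the orbit. -/
theorem orbitMap_injective {b : polydisc n} (hb : Function.Injective b.1) :
    Function.Injective (orbitMap l b) := by
  classical
  rw [injective_iff_map_eq_zero]
  intro x hx
  ext τ
  have h : ⟪polyFun n l (orbitBasis b.1 ⇑τ⁻¹), orbitMap l b x⟫_ℂ = x.coeff τ := by
    rw [orbitMap_eq_sum, inner_sum, Finset.sum_eq_single τ]
    · rw [inner_smul_right, inner_polyFun_kernelAt, coe_permAct, eval_orbitBasis hb]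
      simp
    · intro σ _ hσ
      rw [inner_smul_right, inner_polyFun_kernelAt, coe_permAct, eval_orbitBasis hb,
        if_neg fun h => hσ (inv_injective (DFunLike.coe_injective h))]
      simp
    · simp
  rw [← h, hx, inner_zero_right]
  simp

variable {p : n.Partition} (T : Tableau p)

theorem coe_isotypicProj'_orbitMap (b : polydisc n)
    (x : MonoidAlgebra ℂ (Equiv.Perm (Fin n))) :
    (isotypicProj' l T (orbitMap l b x) : BergmanSpace n l) =
      orbitMap l b (centralIdem T * x) := by
  rw [coe_isotypicProj', isotypicProj_eq, orbitMap_apply, orbitMap_apply, map_mul]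
  rfl

theorem isotypicProj'_orbitMap_mem (b : polydisc n)
    (x : MonoidAlgebra ℂ (Equiv.Perm (Fin n))) :
    isotypicProj' l T (orbitMap l b x) ∈
      moduleTensor (isotypicModule l T) (symmetrization n b.1) := by
  rw [moduleTensor, Submodule.mem_orthogonal']
  intro u hu
  induction hu using Submodule.span_induction with
  | zero => exact inner_zero_right _
  | add u v _ _ hu hv => rw [inner_add_right, hu, hv, add_zero]
  | smul c u _ hu => rw [inner_smul_right, hu, mul_zero]
  | mem u hu =>
    obtain ⟨q, f, rfl⟩ := hu
    rw [inner_isotypicProj', orbitMap_eq_sum, sum_inner]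
    refine Finset.sum_eq_zero fun σ _ => ?_
    rw [inner_smul_left, inner_kernelAt, isotypicModule_apply, symmetrization_permAct]
    simp

/-- An element of the module tensor product at `s(b)` is orthogonal to the multiples of
`s_k - s_k(b)` in the whole Bergman space, because the isotypic projection commutes with
multiplication by symmetric polynomials. -/
theorem inner_polyFun_eq_zero {b : Fin n → ℂ} {f : isotypic l T}
    (hf : f ∈ moduleTensor (isotypicModule l T) (symmetrization n b))
    {r : MvPolynomial (Fin n) ℂ}
    (hr : r ∈ Ideal.span (Set.range fun k : Fin n => MvPolynomial.esymm (Fin n) ℂ (k + 1) -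
        MvPolynomial.C (symmetrization n b k))) :
    ⟪polyFun n l r, (f : BergmanSpace n l)⟫_ℂ = 0 := by
  obtain ⟨c, rfl⟩ := Ideal.mem_span_range_iff_exists_fun.1 hr
  rw [map_sum, sum_inner]
  refine Finset.sum_eq_zero fun k _ => ?_
  set g : MvPolynomial (Fin n) ℂ := MvPolynomial.esymm (Fin n) ℂ (k + 1) -
    MvPolynomial.C (symmetrization n b k) with hg
  have hsymm : g.IsSymmetric :=
    (MvPolynomial.symmetricSubalgebra (Fin n) ℂ).sub_mem
      (MvPolynomial.esymm_isSymmetric (Fin n) ℂ (k + 1)) (MvPolynomial.IsSymmetric.C _)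
  have h1 : polyFun n l (c k * g) = mulOp g (polyFun n l (c k)) :=
    RKHS.ext fun z => by rw [mulOp_apply, polyFun_apply, polyFun_apply, map_mul, mul_comm]
  let u := isotypicProj' l T (polyFun n l (c k))
  have h2 : isotypicProj' l T (mulOp g (polyFun n l (c k))) =
      isotypicModule l T (MvPolynomial.X k - MvPolynomial.C
        (MvPolynomial.eval (symmetrization n b) (MvPolynomial.X k))) u := by
    refine Subtype.ext (RKHS.ext fun z => ?_)
    rw [isotypicModule_apply, coe_isotypicProj', ← mulOp_isotypicProj l T hsymm, mulOp_apply, hg]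
    simp only [map_sub, MvPolynomial.eval_X, MvPolynomial.eval_C, u, coe_isotypicProj']
    rfl
  rw [h1, ← inner_isotypicProj', h2]
  exact (Submodule.mem_orthogonal _ _).1 hf _
    (Submodule.subset_span ⟨MvPolynomial.X k, u, rfl⟩)

/-- Every element of the module tensor product at `s(b)` is a combination of the kernel functions
on the orbit of `b`: its inner products with the polynomials factor through the values on the
orbit, by interpolation. -/
theorem exists_orbitMap_eq {b : polydisc n} (hb : Function.Injective b.1) {f : isotypic l T}
    (hf : f ∈ moduleTensor (isotypicModule l T) (symmetrization n b.1)) :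
    ∃ x, (f : BergmanSpace n l) = orbitMap l b x := by
  refine ⟨∑ σ : Equiv.Perm (Fin n), MonoidAlgebra.single σ⁻¹
    ⟪polyFun n l (orbitBasis b.1 σ), (f : BergmanSpace n l)⟫_ℂ, ?_⟩
  rw [← sub_eq_zero]
  refine eq_zero_of_forall_inner_polynomial _ fun q => ?_
  change ⟪polyFun n l q, _⟫_ℂ = 0
  have h1 := inner_polyFun_eq_zero T hf (sub_sum_orbitBasis_mem hb q)
  rw [map_sub, inner_sub_left, sub_eq_zero, map_sum, sum_inner] at h1
  rw [inner_sub_right, h1, map_sum, inner_sum, ← Finset.sum_sub_distrib]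
  refine Finset.sum_eq_zero fun σ _ => ?_
  have h2 : orbitMap l b (MonoidAlgebra.single σ⁻¹
      ⟪polyFun n l (orbitBasis b.1 σ), (f : BergmanSpace n l)⟫_ℂ) =
        ⟪polyFun n l (orbitBasis b.1 σ), (f : BergmanSpace n l)⟫_ℂ •
          kernelAt n l (permAct σ⁻¹ b) := by
    classical
    rw [orbitMap_eq_sum]
    simp [Finsupp.single_apply, ite_smul]
  rw [h2, map_smul, inner_smul_left, inner_smul_right, inner_polyFun_kernelAt, coe_permAct,
    inv_inv, mul_comm, sub_self]

theorem isOpen_injective : IsOpen {z : Fin n → ℂ | Function.Injective z} := by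
  have : {z : Fin n → ℂ | Function.Injective z} =
      ⋂ i, ⋂ j, {z : Fin n → ℂ | i ≠ j → z i ≠ z j} := by
    ext z
    simp only [Set.mem_iInter, Set.mem_ofPred_eq, Function.Injective, ne_eq, not_imp_not]
  rw [this]
  refine isOpen_iInter_of_finite fun i => isOpen_iInter_of_finite fun j => ?_
  by_cases hij : i = j
  · simp [hij]
  · simpa [hij] using isOpen_ne_fun (continuous_apply i) (continuous_apply j)

/-- Local freeness at a regular value: a basis `v_j` of the ideal generated by the central
idempotent gives the frame `∑ σ, v_j(σ) K(·, σ · b)`, where `conj b` is the value of a holomorphic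
local section of the symmetrization map. -/
theorem isLocallyFreeAt_of_injective {a : polydisc n} (ha : Function.Injective a.1) :
    IsLocallyFreeAt (isotypicModule l T) (youngDegree T ^ 2)
      (star (symmetrization n a.1)) := by
  have ha' : Function.Injective (star a.1) := fun i j h => ha (star_injective h)
  have hV : polydisc n ∩ {z | Function.Injective z} ∈ nhds (star a.1) :=
    (isOpen_polydisc.inter isOpen_injective).mem_nhds ⟨fun i => by simpa using a.2 i, ha'⟩
  obtain ⟨U, ψ, hU, haU, hψ, hψU⟩ := exists_local_section ha' hV
  obtain ⟨F, hF, hFk⟩ := exists_holomorphic_kernel n l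
  let v := Module.finBasisOfFinrankEq ℂ _ (finrank_range_mulLeft_centralIdem T)
  have hv (j) : centralIdem T * (v j).1 = (v j).1 := by
    obtain ⟨x, hx⟩ := (v j).2
    rw [← hx, LinearMap.mulLeft_apply, ← mul_assoc, (isIdempotentElem_centralIdem T).eq]
  refine ⟨U, hU, by rwa [← symmetrization_star],
    fun j z => isotypicProj' l T (permRep n l (v j).1 (F (ψ z))), fun j => ?_, fun z hz => ?_⟩
  · have h1 : DifferentiableOn ℂ (fun z => F (ψ z)) U :=
      hF.comp hψ fun w hw => (hψU w hw).2.1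
    exact ((isotypicProj' l T).comp (permRep n l (v j).1)).differentiable.comp_differentiableOn h1
  · obtain ⟨hsz, hD, hinj⟩ := hψU z hz
    let b : polydisc n := ⟨star (ψ z), fun i => by simpa using hD i⟩
    have hb : Function.Injective b.1 := fun i j h => hinj (star_injective h)
    have hbz : star z = symmetrization n b.1 := by
      rw [← hsz]
      exact (symmetrization_star _).symm
    have hFb : F (ψ z) = kernelAt n l b := by rw [← hFk b, star_star]
    have hγ (j) : isotypicProj' l T (permRep n l (v j).1 (F (ψ z))) =
        isotypicProj' l T (orbitMap l b (v j).1) := by rw [hFb, orbitMap_apply]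
    simp only [hγ, hbz]
    constructor
    · refine LinearIndependent.of_comp (isotypic l T).subtype ?_
      have h1 := (v.linearIndependent.map' (Submodule.subtype _) (Submodule.ker_subtype _)).map'
        (orbitMap l b) (LinearMap.ker_eq_bot.2 (orbitMap_injective hb))
      have h2 : (isotypic l T).subtype ∘ (fun j => isotypicProj' l T (orbitMap l b (v j).1)) =
          orbitMap l b ∘ Submodule.subtype _ ∘ v := funext fun j => by
        simp only [Function.comp_apply, Submodule.subtype_apply, coe_isotypicProj'_orbitMap, hv]
      rw [h2]
      exact h1
    · refine le_antisymm (Submodule.span_le.2 ?_) fun f hf => ?_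
      · rintro _ ⟨j, rfl⟩
        exact isotypicProj'_orbitMap_mem T b _
      · obtain ⟨x, hx⟩ := exists_orbitMap_eq T hb hf
        have h1 : f = isotypicProj' l T (orbitMap l b (centralIdem T * x)) := by
          rw [← coe_isotypicProj'_orbitMap, isotypicProj'_coe, ← hx, isotypicProj'_coe]
        let y : LinearMap.range (LinearMap.mulLeft ℂ (centralIdem T)) :=
          ⟨centralIdem T * x, x, rfl⟩
        have h2 := congrArg (Submodule.subtype _) (v.sum_repr y)
        simp only [map_sum, map_smul, Submodule.subtype_apply, y] at h2
        rw [h1, ← h2]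
        simp only [map_sum, map_smul]
        exact Submodule.sum_mem _ fun j _ =>
          Submodule.smul_mem _ _ (Submodule.subset_span ⟨j, rfl⟩)

end tensor

end BergmanPolydisc

theorem corollary2p13 (n : ℕ) (l : ℝ) [Fact (0 < l)] (p : n.Partition)
    (T : BergmanPolydisc.Tableau p) :
    CompleteSpace (BergmanPolydisc.isotypic l T) ∧
      BergmanPolydisc.IsLocallyFreeOn (BergmanPolydisc.isotypicModule l T)
        (BergmanPolydisc.youngDegree T ^ 2)
        (BergmanPolydisc.symmetrizedPolydisc n \
          BergmanPolydisc.symmetrization n '' BergmanPolydisc.diagonalLocus n) := by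
  refine ⟨(BergmanPolydisc.isClosed_isotypic T).completeSpace_coe, fun w hw => ?_⟩
  obtain ⟨⟨a, ha, haw⟩, hdiag⟩ := hw
  have hinj : Function.Injective a := by
    intro i j hij
    by_contra hne
    exact hdiag ⟨a, ⟨ha, i, j, hne, hij⟩, haw⟩
  have h := BergmanPolydisc.isLocallyFreeAt_of_injective (l := l) T (a := ⟨a, ha⟩) hinj
  rwa [haw, star_star] at h
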